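/- **Setting.** Fix $\gamma,\tilde\gamma,T_-,T_+>0$ and $\bar\tau_+\in\mathbb R$. For $n\ge 1$ let $\mathbb T_n=\{0,\dots,n\}$ and $\Omega_n=\mathbb R^n\times\mathbb R^{n+1}$, with points $(\mathbf r,\mathbf p)=(r_1,\dots,r_n,p_0,\dots,p_n)$ and the convention $r_0:=0$. Put $\mathcal E_x=\frac12p_x^2+\frac12r_x^2$. Let $(\mathbf r^{(n)}(t),\mathbf p^{(n)}(t))_{t\ge0}$ be a càdlàg $\Omega_n$-valued process with random initial condition and generator $L_n=n^2(A+\gamma S+\tilde\gamma\tilde S)$, where $$A=\sum_{x=1}^n(p_x-p_{x-1})\partial_{r_x}+\sum_{x=1}^{n-1}(r_{x+1}-r_x)\partial_{p_x}+r_1\partial_{p_0}+(\bar\tau_+-r_n)\partial_{p_n},$$ $$SF(\mathbf r,\mathbf p)=\sum_{x=0}^n\big(F(\mathbf r,\mathbf p^x)-F(\mathbf r,\mathbf p)\big),\qquad \tilde S=\big(T_-\partial_{p_0}^2-p_0\partial_{p_0}\big)+\big(T_+\partial_{p_n}^2-p_n\partial_{p_n}\big),$$ and $\mathbf p^x$ is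 $\mathbf p$ with $p_x$ replaced by $-p_x$. That is, the process solves the martingale problem for $L_n$ on compactly supported $C^2$ functions. Write $\mathbb E_n$ for the expectation and $$\bar r_x^{(n)}(t)=\mathbb E_n[r^{(n)}_x(t)],\qquad \bar p_x^{(n)}(t)=\mathbb E_n[p^{(n)}_x(t)],\qquad \bar{\mathcal E}_x^{(n)}(t)=\mathbb E_n[\mathcal E_x(\mathbf r^{(n)}(t),\mathbf p^{(n)}(t))].$$ For $f:\mathbb T_n\to\mathbb R$ and $k\in\widehat{\mathbb T}_n=\{0,\frac1{n+1},\dots,\frac n{n+1}\}$ let $\widehat f(k)=\sum_{x\in\mathbb T_n}f_xe^{-2\pi ixk}$. **Assumptions on the initial data.** $$\sup_{n\ge1}\frac1{n+1}\sum_{x\in\mathbb T_n}\bar{\mathcal E}^{(n)}_x(0)<\infty,\qquad \sup_{n\ge1}\Big(\sup_{k\in\widehat{\mathbb T}_n}\big|\widehat{\bar r^{(n)}(0)}(k)\big|+\sup_{k\in\widehat{\mathbb T}_n}\big|\widehat{\bar p^{(n)}(0)}(k)\big|\Big)<\infty .$$ **Proposition.** Under these assumptions all the averages $\bar r_x^{(n)}(s),\bar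 p_x^{(n)}(s)$, $s\ge 0$, are well defined (the random variables are integrable), and for every $t>0$ there is a constant $C>0$, independent of $n$, such that for all $n\ge1$ $$\frac1{n+1}\sup_{s\in[0,t]}\sum_{x\in\mathbb T_n}\Big\{\big(\bar r_x^{(n)}(s)\big)^2+\big(\bar p_x^{(n)}(s)\big)^2\Big\}\le C .$$ In addition, for every $t>0$ there is a constant $C>0$, independent of $n$, such that for all $n\ge1$ $$n\sum_{x\in\mathbb T_n}\int_0^t\big(\bar p_x^{(n)}(s)\big)^2\,ds\le C .$$ -/

import Mathlib

open MeasureTheory Filter Topology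
open scoped NNReal

noncomputable section

namespace OscillatorChain

/-- Configurations `(r_1, …, r_n, p_0, …, p_n) ∈ ℝⁿ × ℝⁿ⁺¹`. The stretch `r_{i+1}` is `z.1 i` for
`i : Fin n`, and the momentum `p_x` is `z.2 x` for `x : Fin (n + 1)`. -/
abbrev Config (n : ℕ) : Type := (Fin n → ℝ) × (Fin (n + 1) → ℝ)

variable {n : ℕ}

/-- The stretches indexed by all sites `x = 0, …, n`, with the convention `r_0 = 0`. -/
def stretch (z : Config n) : Fin (n + 1) → ℝ := Fin.cons (α := fun _ => ℝ) 0 z.1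

/-- The momenta `p_x`, `x = 0, …, n`. -/
def momentum (z : Config n) : Fin (n + 1) → ℝ := z.2

/-- The microscopic energy `p_x² / 2 + r_x² / 2` of the site `x`. -/
def energy (z : Config n) (x : Fin (n + 1)) : ℝ :=
  momentum z x ^ 2 / 2 + stretch z x ^ 2 / 2

/-- The tension acting on site `x` from the right: `r_{x+1}` if `x < n`, and the external tension
`τ` if `x = n`. -/
def rightTension (τ : ℝ) (z : Config n) : Fin (n + 1) → ℝ := Fin.snoc (α := fun _ => ℝ) z.1 τ

/-- The partial derivative `∂F / ∂r_{i+1}`. -/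
def partialStretch (i : Fin n) (F : Config n → ℝ) (z : Config n) : ℝ :=
  fderiv ℝ F z (Pi.single i 1, 0)

/-- The partial derivative `∂F / ∂p_x`. -/
def partialMomentum (x : Fin (n + 1)) (F : Config n → ℝ) (z : Config n) : ℝ :=
  fderiv ℝ F z (0, Pi.single x 1)

/-- The configuration in which the momentum `p_x` is replaced by `-p_x`. -/
def flipMomentum (x : Fin (n + 1)) (z : Config n) : Config n := (z.1, Function.update z.2 x (-z.2 x))

/-- The Hamiltonian part of the generator:
`∑_{x=1}^n (p_x - p_{x-1}) ∂_{r_x} + ∑_{x=1}^{n-1} (r_{x+1} - r_x) ∂_{p_x} + r_1 ∂_{p_0}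
+ (τ - r_n) ∂_{p_n}`. The three momentum terms are written as one sum over `x = 0, …, n`. -/
def hamiltonianPart (τ : ℝ) (F : Config n → ℝ) (z : Config n) : ℝ :=
  (∑ i : Fin n, (momentum z i.succ - momentum z i.castSucc) * partialStretch i F z) +
    ∑ x : Fin (n + 1), (rightTension τ z x - stretch z x) * partialMomentum x F z

/-- The momentum flips: `∑_x (F(r, p^x) - F(r, p))`. -/
def flipPart (F : Config n → ℝ) (z : Config n) : ℝ :=
  ∑ x : Fin (n + 1), (F (flipMomentum x z) - F z)

/-- The Langevin thermostat at temperature `T` acting on site `x`: `T ∂²_{p_x} - p_x ∂_{p_x}`. -/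
def thermostat (T : ℝ) (x : Fin (n + 1)) (F : Config n → ℝ) (z : Config n) : ℝ :=
  T * partialMomentum x (partialMomentum x F) z - momentum z x * partialMomentum x F z

/-- The generator `n² (A + γ S + γ' S')` of the chain, in the diffusive time scale, where `A` is the
Hamiltonian part, `S` the momentum flips, and `S'` the two thermostats, at temperature `Tm` at the
left end `x = 0` and `Tp` at the right end `x = n`. -/
def generator (γ γ' τ Tm Tp : ℝ) (F : Config n → ℝ) (z : Config n) : ℝ :=
  (n : ℝ) ^ 2 * (hamiltonianPart τ F z + γ * flipPart F z +
    γ' * (thermostat Tm 0 F z + thermostat Tp (Fin.last n) F z))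

/-- `X` is a (càdlàg) Markov evolution of the chain of `n + 1` oscillators under `P`, started from
an arbitrary (random) initial configuration: it solves the martingale problem for `generator` on
compactly supported functions of class `C²`. -/
structure IsChainProcess (γ γ' τ Tm Tp : ℝ) {Ω : Type*} [mΩ : MeasurableSpace Ω] (P : Measure Ω)
    (X : ℝ≥0 → Ω → Config n) : Prop where
  isProbabilityMeasure : IsProbabilityMeasure P
  right_continuous : ∀ ω t, ContinuousWithinAt (fun s => X s ω) (Set.Ici t) t
  left_limit : ∀ ω t, ∃ l, Tendsto (fun s => X s ω) (𝓝[<] t) (𝓝 l)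
  martingale_problem : ∃ 𝓕 : Filtration ℝ≥0 mΩ, Adapted 𝓕 X ∧
    ∀ F : Config n → ℝ, ContDiff ℝ 2 F → HasCompactSupport F →
      Martingale (fun (t : ℝ≥0) ω =>
        F (X t ω) - ∫ s in (0 : ℝ)..t, generator γ γ' τ Tm Tp F (X s.toNNReal ω)) 𝓕 P

section Averages

variable {Ω : Type*} [MeasurableSpace Ω]

/-- The mean stretch at site `x` and time `t`. -/
def meanStretch (P : Measure Ω) (X : ℝ≥0 → Ω → Config n) (t : ℝ≥0) (x : Fin (n + 1)) : ℝ :=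
  ∫ ω, stretch (X t ω) x ∂P

/-- The mean momentum at site `x` and time `t`. -/
def meanMomentum (P : Measure Ω) (X : ℝ≥0 → Ω → Config n) (t : ℝ≥0) (x : Fin (n + 1)) : ℝ :=
  ∫ ω, momentum (X t ω) x ∂P

/-- The mean energy at site `x` and time `t`. -/
def meanEnergy (P : Measure Ω) (X : ℝ≥0 → Ω → Config n) (t : ℝ≥0) (x : Fin (n + 1)) : ℝ :=
  ∫ ω, energy (X t ω) x ∂P

end Averages

/-- The discrete Fourier transform `∑_x f_x e^{-2πi x k}` at the frequency `k = j / (n + 1)`. -/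
def discreteFourier (f : Fin (n + 1) → ℝ) (j : Fin (n + 1)) : ℂ :=
  ∑ x : Fin (n + 1), (f x : ℂ) *
    Complex.exp (-(2 * Real.pi * Complex.I * (x : ℕ) * ((j : ℕ) / ((n : ℂ) + 1))))

/-- The energy bound on the initial data: the initial energies have finite expectation, and the
mean energy per site is bounded uniformly in `n ≥ 1`. -/
def InitialEnergyBound {Ω : ℕ → Type*} [∀ n, MeasurableSpace (Ω n)] (P : ∀ n, Measure (Ω n))
    (X : ∀ n, ℝ≥0 → Ω n → Config n) : Prop :=
  ∃ K : ℝ, ∀ n : ℕ, 1 ≤ n →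
    (∀ x, Integrable (fun ω => energy (X n 0 ω) x) (P n)) ∧
      1 / ((n : ℝ) + 1) * ∑ x, meanEnergy (P n) (X n) 0 x ≤ K

/-- The uniform bound on the Fourier transforms of the initial mean stretches and momenta. -/
def InitialSpectralBound {Ω : ℕ → Type*} [∀ n, MeasurableSpace (Ω n)] (P : ∀ n, Measure (Ω n))
    (X : ∀ n, ℝ≥0 → Ω n → Config n) : Prop :=
  ∃ K : ℝ, ∀ n : ℕ, 1 ≤ n → ∀ j k : Fin (n + 1),
    ‖discreteFourier (meanStretch (P n) (X n) 0) j‖ +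
      ‖discreteFourier (meanMomentum (P n) (X n) 0) k‖ ≤ K

end OscillatorChain

end

open OscillatorChain

/-! The mean configuration obeys a closed linear equation. On a linear function the second-order
part of the thermostats vanishes and the flips act as a friction of rate `2γ`, so the generator
sends a linear `L` to `n² L(drift z)`, with no trace of the temperatures
(`tendsto_generator_testFunction`, `IsChainProcess.integral_config_eq`).

This equation has an explicit stationary solution, `stationaryConfig`: all momenta equal a velocity
`v` of order `1/n`, and the stretches are bounded by `|τ|`, so its energy is `O(n)`. The deviation
from it solves the equation at zero tension, for which the Hamiltonian part conserves energy and
friction dissipates it at rate at least `2γ n² ∑ p_x²` (`totalEnergy_deviation_add_le`). By Jensen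
and the initial energy bound, the deviation starts with energy `O(n)`. Its energy therefore stays
`O(n)`, which is the first estimate, and the time integral of `∑ (p_x - v)²` is `O(n)/n² = O(1/n)`.
Since `(n + 1) v²` is also `O(1/n)`, the second estimate follows.

The analytic work is to derive the equation of the means from a martingale problem posed only for
compactly supported functions. Test functions are linear functions multiplied by a `C²` cutoff of
the energy. A Lyapunov argument with the cutoff alone and Fatou's lemma bound the mean energy at
later times (`IsChainProcess.lintegral_totalEnergy_le`); this bound, possibly poor in `n`, supplies
the domination needed to remove the cutoff. -/

noncomputable section

namespace OscillatorChain

variable {n : ℕ}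

/-! ### The energy as a quadratic form, and the drift -/

/-- The total energy of a configuration. -/
def totalEnergy (z : Config n) : ℝ := ∑ x, energy z x

lemma totalEnergy_eq (z : Config n) :
    totalEnergy z = (∑ i, z.1 i ^ 2) / 2 + (∑ x, z.2 x ^ 2) / 2 := by
  simp only [totalEnergy, energy, momentum, stretch, Finset.sum_add_distrib, ← Finset.sum_div]
  rw [Fin.sum_univ_succ (f := fun x => (Fin.cons (α := fun _ => ℝ) 0 z.1 x : ℝ) ^ 2)]
  simp [add_comm]

/-- The differential of the total energy. -/
def energyDifferential (z : Config n) : Config n →L[ℝ] ℝ :=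
  (∑ i, z.1 i • (ContinuousLinearMap.proj (R := ℝ) (φ := fun _ : Fin n => ℝ) i).comp
    (ContinuousLinearMap.fst ℝ (Fin n → ℝ) (Fin (n + 1) → ℝ))) +
  ∑ x, z.2 x • (ContinuousLinearMap.proj (R := ℝ) (φ := fun _ : Fin (n + 1) => ℝ) x).comp
    (ContinuousLinearMap.snd ℝ (Fin n → ℝ) (Fin (n + 1) → ℝ))

lemma energyDifferential_apply (z h : Config n) :
    energyDifferential z h = ∑ i, z.1 i * h.1 i + ∑ x, z.2 x * h.2 x := by
  simp [energyDifferential]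

lemma energyDifferential_single (z : Config n) (x : Fin (n + 1)) :
    energyDifferential z (0, Pi.single x 1) = z.2 x := by
  simp [energyDifferential_apply, Pi.single_apply]

lemma hasFDerivAt_totalEnergy (z : Config n) :
    HasFDerivAt totalEnergy (energyDifferential z) z := by
  have h1 : ∀ i : Fin n, HasFDerivAt (fun z : Config n => z.1 i)
      ((ContinuousLinearMap.proj (R := ℝ) (φ := fun _ : Fin n => ℝ) i).comp
        (ContinuousLinearMap.fst ℝ (Fin n → ℝ) (Fin (n + 1) → ℝ))) z := fun i =>
    ((ContinuousLinearMap.proj (R := ℝ) (φ := fun _ : Fin n => ℝ) i).comp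
        (ContinuousLinearMap.fst ℝ (Fin n → ℝ) (Fin (n + 1) → ℝ))).hasFDerivAt
  have h2 : ∀ x : Fin (n + 1), HasFDerivAt (fun z : Config n => z.2 x)
      ((ContinuousLinearMap.proj (R := ℝ) (φ := fun _ : Fin (n + 1) => ℝ) x).comp
        (ContinuousLinearMap.snd ℝ (Fin n → ℝ) (Fin (n + 1) → ℝ))) z := fun x =>
    ((ContinuousLinearMap.proj (R := ℝ) (φ := fun _ : Fin (n + 1) => ℝ) x).comp
        (ContinuousLinearMap.snd ℝ (Fin n → ℝ) (Fin (n + 1) → ℝ))).hasFDerivAt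
  have h := ((HasFDerivAt.fun_sum (u := Finset.univ) fun i _ => (h1 i).pow 2).mul_const (2⁻¹ : ℝ)).add
    ((HasFDerivAt.fun_sum (u := Finset.univ) fun x _ => (h2 x).pow 2).mul_const (2⁻¹ : ℝ))
  have he : (totalEnergy : Config n → ℝ) = fun z => (∑ i, z.1 i ^ 2) * 2⁻¹ + (∑ x, z.2 x ^ 2) * 2⁻¹ := by
    funext z; rw [totalEnergy_eq]; ring
  rw [he]
  refine h.congr_fderiv ?_
  ext v <;> simp [energyDifferential_apply, Finset.mul_sum, mul_assoc]

lemma contDiff_totalEnergy {k : WithTop ℕ∞} : ContDiff ℝ k (totalEnergy : Config n → ℝ) := by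
  have he : (totalEnergy : Config n → ℝ) = fun z => (∑ i, z.1 i ^ 2) / 2 + (∑ x, z.2 x ^ 2) / 2 := by
    funext z; rw [totalEnergy_eq]
  rw [he]
  fun_prop

lemma continuous_totalEnergy : Continuous (totalEnergy : Config n → ℝ) :=
  (contDiff_totalEnergy (k := 0)).continuous

lemma totalEnergy_nonneg (z : Config n) : 0 ≤ totalEnergy z := by
  rw [totalEnergy_eq]; positivity

lemma sq_momentum_le (z : Config n) (x : Fin (n + 1)) : z.2 x ^ 2 ≤ 2 * totalEnergy z := by
  have h := Finset.single_le_sum (f := fun x => z.2 x ^ 2) (fun _ _ => sq_nonneg _)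
    (Finset.mem_univ x)
  have h2 : 0 ≤ ∑ i, z.1 i ^ 2 := by positivity
  rw [totalEnergy_eq]; linarith

lemma sq_stretch_le (z : Config n) (i : Fin n) : z.1 i ^ 2 ≤ 2 * totalEnergy z := by
  have h := Finset.single_le_sum (f := fun i => z.1 i ^ 2) (fun _ _ => sq_nonneg _)
    (Finset.mem_univ i)
  have h2 : 0 ≤ ∑ x, z.2 x ^ 2 := by positivity
  rw [totalEnergy_eq]; linarith

/-- Used twice over: energy sublevel sets are bounded, so energy cutoffs have compact support, and
integrable energy dominates every linear function. -/
lemma norm_le_one_add_totalEnergy (z : Config n) : ‖z‖ ≤ 1 + totalEnergy z := by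
  have h0 := totalEnergy_nonneg z
  have aux : ∀ a : ℝ, a ^ 2 ≤ 2 * totalEnergy z → ‖a‖ ≤ 1 + totalEnergy z := fun a ha => by
    rw [Real.norm_eq_abs]
    nlinarith [sq_abs a, sq_nonneg (|a| - 1)]
  rw [Prod.norm_def, max_le_iff]
  exact ⟨(pi_norm_le_iff_of_nonneg (by linarith)).2 fun i => aux _ (sq_stretch_le z i),
    (pi_norm_le_iff_of_nonneg (by linarith)).2 fun i => aux _ (sq_momentum_le z i)⟩

/-- This is the reason for cutting off through the energy: the flips do not see the cutoff. -/
lemma totalEnergy_flipMomentum (x : Fin (n + 1)) (z : Config n) :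
    totalEnergy (flipMomentum x z) = totalEnergy z := by
  simp only [totalEnergy, energy, momentum, stretch, flipMomentum]
  refine Finset.sum_congr rfl fun y _ => ?_
  by_cases h : y = x
  · subst h; simp
  · simp [h]

/-- The vector field of the Hamiltonian part. -/
def hamiltonianField (τ : ℝ) (z : Config n) : Config n :=
  (fun i => z.2 i.succ - z.2 i.castSucc, fun x => rightTension τ z x - stretch z x)

/-- Summation by parts cancels all bulk terms, because `r_0 = 0`; only the work of the external
tension remains. -/
lemma energyDifferential_hamiltonianField (τ : ℝ) (z : Config n) :
    energyDifferential z (hamiltonianField τ z) = τ * z.2 (Fin.last n) := by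
  rw [energyDifferential_apply]
  simp only [hamiltonianField, rightTension, stretch, mul_sub, Finset.sum_sub_distrib]
  rw [Fin.sum_univ_castSucc (f := fun x => z.2 x * (Fin.snoc (α := fun _ => ℝ) z.1 τ x : ℝ)),
    Fin.sum_univ_succ (f := fun x => z.2 x * (Fin.cons (α := fun _ => ℝ) 0 z.1 x : ℝ))]
  simp [mul_comm]

lemma config_decomposition (w : Config n) :
    w = ∑ i, w.1 i • ((Pi.single i 1, 0) : Config n) + ∑ x, w.2 x • ((0, Pi.single x 1) : Config n) := by
  ext j <;> simp [Prod.fst_sum, Prod.snd_sum, Finset.sum_apply, Pi.single_apply]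

lemma map_config (L : Config n →L[ℝ] ℝ) (w : Config n) :
    L w = ∑ i, w.1 i * L (Pi.single i 1, 0) + ∑ x, w.2 x * L (0, Pi.single x 1) := by
  conv_lhs => rw [config_decomposition w]
  simp only [map_add, map_sum, map_smul, smul_eq_mul]

lemma hamiltonianPart_eq (τ : ℝ) (F : Config n → ℝ) (z : Config n) :
    hamiltonianPart τ F z = fderiv ℝ F z (hamiltonianField τ z) := by
  rw [map_config]
  rfl

/-- The drift of the chain, without the factor `n²`. -/
def drift (γ γ' τ : ℝ) (z : Config n) : Config n :=
  hamiltonianField τ z - (2 * γ) • (0, z.2) - (γ' * z.2 0) • (0, Pi.single 0 1) -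
    (γ' * z.2 (Fin.last n)) • (0, Pi.single (Fin.last n) 1)

/-! ### The generator on affine functions times a function of the energy -/

section TestFunctions

variable (c : ℝ) (L : Config n →L[ℝ] ℝ) {φ φ₁ φ₂ : ℝ → ℝ}

/-- An affine function times a function of the total energy. -/
def testFunction (φ : ℝ → ℝ) (z : Config n) : ℝ := (c + L z) * φ (totalEnergy z)

lemma hasFDerivAt_testFunction (h1 : ∀ v, HasDerivAt φ (φ₁ v) v) (z : Config n) :
    HasFDerivAt (testFunction c L φ)
      (φ (totalEnergy z) • L + ((c + L z) * φ₁ (totalEnergy z)) • energyDifferential z) z := by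
  have h := (L.hasFDerivAt (x := z)).const_add c |>.mul
    ((h1 (totalEnergy z)).comp_hasFDerivAt z (hasFDerivAt_totalEnergy z))
  refine h.congr_fderiv ?_
  ext v <;> simp <;> ring

lemma partialMomentum_testFunction (h1 : ∀ v, HasDerivAt φ (φ₁ v) v) (x : Fin (n + 1)) :
    partialMomentum x (testFunction c L φ) = fun z =>
      testFunction (L (0, Pi.single x 1)) 0 φ z + testFunction c L φ₁ z * z.2 x := by
  funext z
  rw [partialMomentum, (hasFDerivAt_testFunction c L h1 z).fderiv]
  simp [testFunction, energyDifferential_single]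
  ring

lemma partialMomentum_partialMomentum_testFunction (h1 : ∀ v, HasDerivAt φ (φ₁ v) v)
    (h2 : ∀ v, HasDerivAt φ₁ (φ₂ v) v) (x : Fin (n + 1)) (z : Config n) :
    partialMomentum x (partialMomentum x (testFunction c L φ)) z =
      2 * L (0, Pi.single x 1) * φ₁ (totalEnergy z) * z.2 x +
        (c + L z) * (φ₂ (totalEnergy z) * z.2 x ^ 2 + φ₁ (totalEnergy z)) := by
  rw [partialMomentum_testFunction c L h1]
  have hp : HasFDerivAt (fun z : Config n => z.2 x)
      ((ContinuousLinearMap.proj (R := ℝ) (φ := fun _ : Fin (n + 1) => ℝ) x).comp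
        (ContinuousLinearMap.snd ℝ (Fin n → ℝ) (Fin (n + 1) → ℝ))) z :=
    ((ContinuousLinearMap.proj (R := ℝ) (φ := fun _ : Fin (n + 1) => ℝ) x).comp
        (ContinuousLinearMap.snd ℝ (Fin n → ℝ) (Fin (n + 1) → ℝ))).hasFDerivAt
  have h := (hasFDerivAt_testFunction (L (0, Pi.single x 1)) 0 h1 z).add
    ((hasFDerivAt_testFunction c L h2 z).mul hp)
  rw [partialMomentum]
  erw [h.fderiv]
  simp [testFunction, energyDifferential_single]
  ring

/-- Each flip translates `z` by `-2 p_x` along one coordinate and leaves the energy unchanged;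
summing the increments of `L` produces the friction term of `drift`. -/
lemma flipPart_testFunction (z : Config n) :
    flipPart (testFunction c L φ) z = -2 * L (0, z.2) * φ (totalEnergy z) := by
  have key : ∀ x, testFunction c L φ (flipMomentum x z) - testFunction c L φ z =
      -2 * φ (totalEnergy z) * (z.2 x * L (0, Pi.single x 1)) := fun x => by
    have hz : flipMomentum x z = z + (-2 * z.2 x) • ((0, Pi.single x 1) : Config n) := by
      ext j
      · simp [flipMomentum]
      · by_cases h : j = x
        · subst h; simp [flipMomentum]; ring
        · simp [flipMomentum, h]
    rw [testFunction, totalEnergy_flipMomentum, hz, map_add, map_smul, testFunction, smul_eq_mul]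
    ring
  rw [flipPart, Finset.sum_congr rfl fun x _ => key x, ← Finset.mul_sum, map_config L (0, z.2)]
  simp
  ring

/-- The factor multiplying the affine function `c + L z` in the generator of `testFunction c L φ`. -/
def cutoffTerm (γ' τ Tm Tp : ℝ) (φ₁ φ₂ : ℝ → ℝ) (z : Config n) : ℝ :=
  φ₁ (totalEnergy z) * (τ * z.2 (Fin.last n)) +
    γ' * (Tm * (φ₂ (totalEnergy z) * z.2 0 ^ 2 + φ₁ (totalEnergy z)) -
        φ₁ (totalEnergy z) * z.2 0 ^ 2 +
      (Tp * (φ₂ (totalEnergy z) * z.2 (Fin.last n) ^ 2 + φ₁ (totalEnergy z)) -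
        φ₁ (totalEnergy z) * z.2 (Fin.last n) ^ 2))

/-- Only the first term survives when the cutoff is removed: the others contain a derivative of `φ`.
The last one is the cross term of the second derivatives in the thermostats. -/
lemma generator_testFunction (γ γ' τ Tm Tp : ℝ) (h1 : ∀ v, HasDerivAt φ (φ₁ v) v)
    (h2 : ∀ v, HasDerivAt φ₁ (φ₂ v) v) (z : Config n) :
    generator γ γ' τ Tm Tp (testFunction c L φ) z =
      (n : ℝ) ^ 2 * (φ (totalEnergy z) * L (drift γ γ' τ z) +
        (c + L z) * cutoffTerm γ' τ Tm Tp φ₁ φ₂ z +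
        2 * γ' * φ₁ (totalEnergy z) * (Tm * L (0, Pi.single 0 1) * z.2 0 +
          Tp * L (0, Pi.single (Fin.last n) 1) * z.2 (Fin.last n))) := by
  rw [generator, hamiltonianPart_eq, (hasFDerivAt_testFunction c L h1 z).fderiv,
    flipPart_testFunction, thermostat, thermostat,
    partialMomentum_partialMomentum_testFunction c L h1 h2,
    partialMomentum_partialMomentum_testFunction c L h1 h2,
    partialMomentum_testFunction c L h1, partialMomentum_testFunction c L h1]
  simp only [add_apply, smul_apply, smul_eq_mul,
    energyDifferential_hamiltonianField, drift, map_sub, map_smul, testFunction, cutoffTerm,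
    momentum, zero_apply]
  ring

end TestFunctions

/-! ### A `C²` cutoff of the energy -/

section Cutoff

/-- An exponent of at least `2` flattens the kink: at the origin the function is dominated by `|h| ^
(k + 2)`, which is `o(h)`. -/
lemma hasDerivAt_max_zero_pow (k : ℕ) (v : ℝ) :
    HasDerivAt (fun v : ℝ => max v 0 ^ (k + 2)) ((k + 2) * max v 0 ^ (k + 1)) v := by
  rcases lt_trichotomy v 0 with h | h | h
  · have : (fun v : ℝ => max v 0 ^ (k + 2)) =ᶠ[𝓝 v] fun _ => 0 := by
      filter_upwards [Iio_mem_nhds h] with w hw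
      simp [max_eq_right (le_of_lt (Set.mem_Iio.1 hw))]
    rw [max_eq_right h.le]
    simpa using (hasDerivAt_const v (0 : ℝ)).congr_of_eventuallyEq this
  · subst h
    rw [hasDerivAt_iff_isLittleO_nhds_zero]
    simp only [zero_add, max_self, ne_eq, Nat.add_eq_zero_iff, OfNat.ofNat_ne_zero, and_false,
      not_false_eq_true, zero_pow, sub_zero, one_ne_zero, mul_zero, smul_zero]
    refine Asymptotics.IsBigO.trans_isLittleO (g := fun h : ℝ => h ^ (k + 2)) ?_ ?_
    · refine Asymptotics.IsBigO.of_bound 1 (Eventually.of_forall fun h => ?_)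
      rw [norm_pow, norm_pow, one_mul]
      refine pow_le_pow_left₀ (norm_nonneg _) ?_ _
      rw [Real.norm_eq_abs, Real.norm_eq_abs, abs_of_nonneg (le_max_right _ _)]
      exact max_le (le_abs_self _) (abs_nonneg _)
    · simpa using Asymptotics.isLittleO_pow_pow (𝕜 := ℝ) (m := 1) (n := k + 2) (by omega)
  · have : (fun v : ℝ => max v 0 ^ (k + 2)) =ᶠ[𝓝 v] fun v => v ^ (k + 2) := by
      filter_upwards [Ioi_mem_nhds h] with w hw
      simp [max_eq_left (le_of_lt (Set.mem_Ioi.1 hw))]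
    rw [max_eq_left h.le]
    simpa using (hasDerivAt_pow (k + 2) v).congr_of_eventuallyEq this

/-- The positive part of `1 - v / R`. -/
def ramp (R v : ℝ) : ℝ := max (1 - v / R) 0

/-- A cutoff of class `C²`, vanishing for `R ≤ v` and converging to `1` as `R → ∞`. -/
def cutoff (R v : ℝ) : ℝ := ramp R v ^ 3

/-- The first derivative of `cutoff`. -/
def cutoffDeriv (R v : ℝ) : ℝ := -(3 / R) * ramp R v ^ 2

/-- The second derivative of `cutoff`. -/
def cutoffDeriv₂ (R v : ℝ) : ℝ := 6 / R ^ 2 * ramp R v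

lemma hasDerivAt_ramp_pow (R : ℝ) (k : ℕ) (v : ℝ) :
    HasDerivAt (fun v => ramp R v ^ (k + 2)) (-((k + 2) / R) * ramp R v ^ (k + 1)) v := by
  have h : HasDerivAt (fun v : ℝ => 1 - v / R) (-(1 / R)) v :=
    ((hasDerivAt_id v).div_const R).const_sub 1
  refine ((hasDerivAt_max_zero_pow k (1 - v / R)).comp v h).congr_deriv ?_
  rw [ramp]; ring

lemma hasDerivAt_cutoff (R v : ℝ) : HasDerivAt (cutoff R) (cutoffDeriv R v) v := by
  refine (hasDerivAt_ramp_pow R 1 v).congr_deriv ?_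
  norm_num [cutoffDeriv]

lemma hasDerivAt_cutoffDeriv (R v : ℝ) :
    HasDerivAt (cutoffDeriv R) (cutoffDeriv₂ R v) v := by
  refine ((hasDerivAt_ramp_pow R 0 v).const_mul (-(3 / R))).congr_deriv ?_
  norm_num [cutoffDeriv₂]
  ring

lemma continuous_ramp (R : ℝ) : Continuous (ramp R) := by unfold ramp; fun_prop

lemma continuous_cutoff (R : ℝ) : Continuous (cutoff R) := (continuous_ramp R).pow 3

lemma continuous_cutoffDeriv (R : ℝ) : Continuous (cutoffDeriv R) :=
  continuous_const.mul ((continuous_ramp R).pow 2)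

lemma continuous_cutoffDeriv₂ (R : ℝ) : Continuous (cutoffDeriv₂ R) :=
  continuous_const.mul (continuous_ramp R)

lemma contDiff_cutoff (R : ℝ) : ContDiff ℝ 2 (cutoff R) := by
  have h1 : deriv (cutoff R) = cutoffDeriv R := funext fun v => (hasDerivAt_cutoff R v).deriv
  have h2 : deriv (cutoffDeriv R) = cutoffDeriv₂ R :=
    funext fun v => (hasDerivAt_cutoffDeriv R v).deriv
  rw [show (2 : WithTop ℕ∞) = 1 + 1 by norm_num, contDiff_succ_iff_deriv]
  refine ⟨fun v => (hasDerivAt_cutoff R v).differentiableAt, by simp, ?_⟩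
  rw [h1, contDiff_one_iff_deriv, h2]
  exact ⟨fun v => (hasDerivAt_cutoffDeriv R v).differentiableAt, continuous_cutoffDeriv₂ R⟩

lemma ramp_nonneg (R v : ℝ) : 0 ≤ ramp R v := le_max_right _ _

lemma ramp_le_one {R v : ℝ} (hR : 0 < R) (hv : 0 ≤ v) : ramp R v ≤ 1 :=
  max_le (by have := div_nonneg hv hR.le; linarith) zero_le_one

lemma ramp_eq_zero {R v : ℝ} (hR : 0 < R) (hv : R ≤ v) : ramp R v = 0 :=
  max_eq_right (by have := (one_le_div hR).2 hv; linarith)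

lemma tendsto_ramp (v : ℝ) : Tendsto (fun m : ℕ => ramp ((m : ℝ) + 1) v) atTop (𝓝 1) := by
  have h : Tendsto (fun m : ℕ => v / ((m : ℝ) + 1)) atTop (𝓝 0) :=
    tendsto_const_nhds.div_atTop (tendsto_atTop_add_const_right _ _ tendsto_natCast_atTop_atTop)
  simpa [ramp] using (h.const_sub 1).max (tendsto_const_nhds (x := (0 : ℝ)))

lemma tendsto_cutoff (v : ℝ) : Tendsto (fun m : ℕ => cutoff ((m : ℝ) + 1) v) atTop (𝓝 1) := by
  simpa [cutoff] using (tendsto_ramp v).pow 3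

lemma tendsto_cutoffDeriv (v : ℝ) :
    Tendsto (fun m : ℕ => cutoffDeriv ((m : ℝ) + 1) v) atTop (𝓝 0) := by
  have h : Tendsto (fun m : ℕ => (3 : ℝ) / ((m : ℝ) + 1)) atTop (𝓝 0) :=
    tendsto_const_nhds.div_atTop (tendsto_atTop_add_const_right _ _ tendsto_natCast_atTop_atTop)
  simpa [cutoffDeriv] using h.neg.mul ((tendsto_ramp v).pow 2)

lemma tendsto_cutoffDeriv₂ (v : ℝ) :
    Tendsto (fun m : ℕ => cutoffDeriv₂ ((m : ℝ) + 1) v) atTop (𝓝 0) := by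
  have h : Tendsto (fun m : ℕ => (6 : ℝ) / ((m : ℝ) + 1) ^ 2) atTop (𝓝 0) :=
    tendsto_const_nhds.div_atTop ((tendsto_pow_atTop two_ne_zero).comp
      (tendsto_atTop_add_const_right _ _ tendsto_natCast_atTop_atTop))
  simpa [cutoffDeriv₂] using h.mul (tendsto_ramp v)

/-- The truncated energy `(R / 3) (1 - cutoff R v)` lies below `v`, and above `0`. -/
lemma truncation_bounds {R v : ℝ} (hR : 0 < R) (hv : 0 ≤ v) :
    0 ≤ R / 3 * (1 - cutoff R v) ∧ R / 3 * (1 - cutoff R v) ≤ v := by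
  have h0 := ramp_nonneg R v
  have h1 := ramp_le_one hR hv
  have h2 : 1 - v / R ≤ ramp R v := le_max_left _ _
  have h3 : ramp R v ^ 3 ≤ 1 := pow_le_one₀ h0 h1
  refine ⟨mul_nonneg (by positivity) (by rw [cutoff]; linarith), ?_⟩
  -- With `u = ramp R v` in `[0, 1]`, `1 - u³ = (1 - u)(1 + u + u²)` and the second factor is at
  -- most `3`; hence the normalization `R / 3`.
  have h4 : 1 - ramp R v ^ 3 ≤ 3 * (1 - ramp R v) := by nlinarith [sq_nonneg (ramp R v - 1)]
  have h5 : 1 - ramp R v ^ 3 ≤ 3 * (v / R) := by linarith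
  calc R / 3 * (1 - cutoff R v) ≤ R / 3 * (3 * (v / R)) := by rw [cutoff]; gcongr
    _ = v := by field_simp

/-- Once `R ≥ v`, `u = 1 - v / R`, so `(R / 3)(1 - u³) = v (1 + u + u²) / 3` with `u → 1`. -/
lemma tendsto_truncation (v : ℝ) :
    Tendsto (fun m : ℕ => ((m : ℝ) + 1) / 3 * (1 - cutoff ((m : ℝ) + 1) v)) atTop (𝓝 v) := by
  have hlim : Tendsto (fun m : ℕ => v * ((1 + ramp ((m : ℝ) + 1) v + ramp ((m : ℝ) + 1) v ^ 2) / 3))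
      atTop (𝓝 v) := by
    have h := ((((tendsto_ramp v).const_add 1).add ((tendsto_ramp v).pow 2)).div_const 3).const_mul v
    norm_num at h
    exact h
  refine hlim.congr' ?_
  filter_upwards [eventually_ge_atTop ⌈v⌉₊] with m hm
  have hv : v ≤ m := (Nat.le_ceil v).trans (by exact_mod_cast hm)
  have hm0 : (0 : ℝ) < m + 1 := by positivity
  have hr : ramp ((m : ℝ) + 1) v = 1 - v / (m + 1) :=
    max_eq_left (by rw [sub_nonneg, div_le_one hm0]; linarith)
  rw [cutoff, hr]
  field_simp
  ring

lemma contDiff_testFunction (c : ℝ) (L : Config n →L[ℝ] ℝ) (R : ℝ) :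
    ContDiff ℝ 2 (testFunction c L (cutoff R)) :=
  (contDiff_const.add L.contDiff).mul ((contDiff_cutoff R).comp contDiff_totalEnergy)

lemma hasCompactSupport_testFunction (c : ℝ) (L : Config n →L[ℝ] ℝ) {R : ℝ} (hR : 0 < R) :
    HasCompactSupport (testFunction c L (cutoff R)) := by
  refine HasCompactSupport.intro (isCompact_closedBall (0 : Config n) (1 + R)) fun z hz => ?_
  have h : R ≤ totalEnergy z := by
    have := norm_le_one_add_totalEnergy z
    simp only [Metric.mem_closedBall, dist_zero_right, not_le] at hz
    linarith
  simp [testFunction, cutoff, ramp_eq_zero hR h]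

end Cutoff

/-! ### Bounds on the generator, uniform in the truncation -/

section GeneratorBounds

variable (γ γ' τ Tm Tp c : ℝ) (L : Config n →L[ℝ] ℝ)

lemma continuous_drift : Continuous (drift γ γ' τ : Config n → Config n) := by
  have h1 : Continuous fun z : Config n => (Fin.snoc (α := fun _ => ℝ) z.1 τ : Fin (n + 1) → ℝ) :=
    Continuous.finSnoc (A := fun _ => ℝ) continuous_fst continuous_const
  have h2 : Continuous fun z : Config n => (Fin.cons (α := fun _ => ℝ) 0 z.1 : Fin (n + 1) → ℝ) :=
    Continuous.finCons (A := fun _ => ℝ) continuous_const continuous_fst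
  have h3 : Continuous (hamiltonianField τ : Config n → Config n) := by
    unfold hamiltonianField rightTension stretch
    exact Continuous.prodMk (by fun_prop) (continuous_pi fun x =>
      ((continuous_apply x).comp h1).sub ((continuous_apply x).comp h2))
  unfold drift
  fun_prop

lemma norm_drift_le (z : Config n) :
    ‖drift γ γ' τ z‖ ≤ |τ| + (2 + 2 * |γ| + 2 * |γ'|) * ‖z‖ := by
  have hz := norm_nonneg z
  have h1 : ∀ i, ‖z.1 i‖ ≤ ‖z‖ := fun i => (norm_le_pi_norm z.1 i).trans (norm_fst_le z)
  have h2 : ∀ x, ‖z.2 x‖ ≤ ‖z‖ := fun x => (norm_le_pi_norm z.2 x).trans (norm_snd_le z)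
  have hr : ∀ x, ‖rightTension τ z x‖ ≤ |τ| + ‖z‖ := fun x => by
    refine Fin.lastCases ?_ (fun i => ?_) x
    · simp [rightTension]
    · simpa [rightTension] using (h1 i).trans (le_add_of_nonneg_left (abs_nonneg τ))
  have hs : ∀ x, ‖stretch z x‖ ≤ ‖z‖ := fun x => by
    refine Fin.cases ?_ (fun i => ?_) x
    · simp [stretch]
    · simpa [stretch] using h1 i
  have hB : ‖hamiltonianField τ z‖ ≤ |τ| + 2 * ‖z‖ := by
    rw [Prod.norm_def, max_le_iff]
    constructor
    · refine (pi_norm_le_iff_of_nonneg (by positivity)).2 fun i => (norm_sub_le _ _).trans ?_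
      linarith [h2 i.succ, h2 i.castSucc, abs_nonneg τ]
    · refine (pi_norm_le_iff_of_nonneg (by positivity)).2 fun x => (norm_sub_le _ _).trans ?_
      linarith [hr x, hs x]
  have hP : ‖(2 * γ) • ((0, z.2) : Config n)‖ ≤ 2 * |γ| * ‖z‖ := by
    rw [norm_smul, Prod.norm_mk, norm_zero, max_eq_right (norm_nonneg _), norm_mul]
    simpa using mul_le_mul_of_nonneg_left (norm_snd_le z) (by positivity : 0 ≤ 2 * |γ|)
  have hT : ∀ x, ‖(γ' * z.2 x) • ((0, Pi.single x 1) : Config n)‖ ≤ |γ'| * ‖z‖ := fun x => by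
    rw [norm_smul, Prod.norm_mk, norm_zero, max_eq_right (norm_nonneg _), Pi.norm_single, norm_one,
      mul_one, norm_mul]
    exact mul_le_mul_of_nonneg_left (h2 x) (abs_nonneg _)
  have := norm_sub_le (hamiltonianField τ z - (2 * γ) • ((0, z.2) : Config n) -
    (γ' * z.2 0) • ((0, Pi.single 0 1) : Config n))
    ((γ' * z.2 (Fin.last n)) • ((0, Pi.single (Fin.last n) 1) : Config n))
  have := norm_sub_le (hamiltonianField τ z - (2 * γ) • ((0, z.2) : Config n))
    ((γ' * z.2 0) • ((0, Pi.single 0 1) : Config n))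
  have := norm_sub_le (hamiltonianField τ z) ((2 * γ) • ((0, z.2) : Config n))
  rw [drift]
  linarith [hT 0, hT (Fin.last n)]

/-- Where the cutoff is nonzero the energy is below `R`, so `p_x² ≤ 2R`, while every derivative of
the cutoff gains a factor `1 / R`. The bounds thus do not depend on `R`. -/
lemma cutoff_bounds {R : ℝ} (hR : 1 ≤ R) (z : Config n) (x : Fin (n + 1)) :
    |cutoff R (totalEnergy z)| ≤ 1 ∧ |cutoffDeriv R (totalEnergy z)| ≤ 3 ∧
      |cutoffDeriv R (totalEnergy z) * z.2 x ^ 2| ≤ 6 ∧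
      |cutoffDeriv R (totalEnergy z) * z.2 x| ≤ 9 ∧
      |cutoffDeriv₂ R (totalEnergy z) * z.2 x ^ 2| ≤ 12 := by
  have hR0 : 0 < R := by linarith
  have h0 := ramp_nonneg R (totalEnergy z)
  have h1 := ramp_le_one hR0 (totalEnergy_nonneg z)
  have hV := totalEnergy_nonneg z
  have hp := sq_momentum_le z x
  set u := ramp R (totalEnergy z) with hu
  have hup : u * (z.2 x ^ 2 / R) ≤ 2 := by
    rcases le_or_gt R (totalEnergy z) with h | h
    · rw [hu, ramp_eq_zero hR0 h]; norm_num
    · have h3 : z.2 x ^ 2 / R ≤ 2 := by rw [div_le_iff₀ hR0]; linarith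
      have h4 : 0 ≤ z.2 x ^ 2 / R := by positivity
      nlinarith
  have hup0 : 0 ≤ u * (z.2 x ^ 2 / R) := by positivity
  have hR1 : 1 / R ≤ 1 := by rw [div_le_one hR0]; exact hR
  have hR2 : 0 < 1 / R := by positivity
  have hd : |cutoffDeriv R (totalEnergy z)| ≤ 3 := by
    rw [cutoffDeriv, ← hu, abs_mul, abs_neg, abs_of_pos (by positivity : 0 < 3 / R),
      abs_of_nonneg (by positivity)]
    have h5 : u ^ 2 ≤ 1 := pow_le_one₀ h0 h1
    have h6 : 3 / R ≤ 3 := by rw [div_le_iff₀ hR0]; linarith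
    have h7 : 0 < 3 / R := by positivity
    nlinarith
  have hd2 : |cutoffDeriv R (totalEnergy z) * z.2 x ^ 2| ≤ 6 := by
    have : cutoffDeriv R (totalEnergy z) * z.2 x ^ 2 = -(3 * u * (u * (z.2 x ^ 2 / R))) := by
      rw [cutoffDeriv, ← hu]; ring
    rw [this, abs_neg, abs_of_nonneg (by positivity)]
    nlinarith
  refine ⟨?_, hd, hd2, ?_, ?_⟩
  · rw [cutoff, ← hu, abs_of_nonneg (by positivity)]
    exact pow_le_one₀ h0 h1
  · rw [abs_mul] at hd2 ⊢
    -- The constant `9` is `3 + 6`, from the two preceding bounds.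
    have h5 : |z.2 x| ≤ 1 + |z.2 x ^ 2| := by
      rw [abs_pow]; nlinarith [sq_nonneg (|z.2 x| - 1), abs_nonneg (z.2 x)]
    nlinarith [abs_nonneg (cutoffDeriv R (totalEnergy z))]
  · have : cutoffDeriv₂ R (totalEnergy z) * z.2 x ^ 2 = 6 * (1 / R) * (u * (z.2 x ^ 2 / R)) := by
      rw [cutoffDeriv₂, ← hu]; ring
    rw [this, abs_of_nonneg (by positivity)]
    nlinarith

lemma abs_thermostat_cutoff_le (T : ℝ) {R : ℝ} (hR : 1 ≤ R) (z : Config n) (x : Fin (n + 1)) :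
    |T * (cutoffDeriv₂ R (totalEnergy z) * z.2 x ^ 2 + cutoffDeriv R (totalEnergy z)) -
      cutoffDeriv R (totalEnergy z) * z.2 x ^ 2| ≤ |T| * 15 + 6 := by
  obtain ⟨-, h2, h3, -, h5⟩ := cutoff_bounds hR z x
  refine (abs_sub _ _).trans (add_le_add ?_ h3)
  rw [abs_mul]
  exact mul_le_mul_of_nonneg_left ((abs_add_le _ _).trans (by linarith)) (abs_nonneg _)

lemma abs_cutoffTerm_le {R : ℝ} (hR : 1 ≤ R) (z : Config n) :
    |cutoffTerm γ' τ Tm Tp (cutoffDeriv R) (cutoffDeriv₂ R) z| ≤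
      |τ| * 9 + |γ'| * ((|Tm| * 15 + 6) + (|Tp| * 15 + 6)) := by
  obtain ⟨-, -, -, h4, -⟩ := cutoff_bounds hR z (Fin.last n)
  refine (abs_add_le _ _).trans (add_le_add ?_ ?_)
  · rw [mul_left_comm, abs_mul]
    exact mul_le_mul_of_nonneg_left h4 (abs_nonneg _)
  · rw [abs_mul]
    exact mul_le_mul_of_nonneg_left ((abs_add_le _ _).trans (add_le_add
      (abs_thermostat_cutoff_le Tm hR z 0) (abs_thermostat_cutoff_le Tp hR z _))) (abs_nonneg _)

/-- The generator of the truncated affine functions grows at most like the energy, uniformly in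
the truncation. -/
lemma exists_abs_generator_le : ∃ C : ℝ, ∀ R : ℝ, 1 ≤ R → ∀ z : Config n,
    |generator γ γ' τ Tm Tp (testFunction c L (cutoff R)) z| ≤ C * (1 + totalEnergy z) := by
  set D := |τ| + (2 + 2 * |γ| + 2 * |γ'|) with hD
  set K := |τ| * 9 + |γ'| * ((|Tm| * 15 + 6) + (|Tp| * 15 + 6)) with hK
  set a := |Tm * L (0, Pi.single 0 1)|
  set b := |Tp * L (0, Pi.single (Fin.last n) 1)|
  refine ⟨(n : ℝ) ^ 2 * (‖L‖ * D + (|c| + ‖L‖) * K + 2 * |γ'| * (9 * a + 9 * b)),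
    fun R hR z => ?_⟩
  rw [generator_testFunction c L γ γ' τ Tm Tp (hasDerivAt_cutoff R) (hasDerivAt_cutoffDeriv R) z,
    abs_mul, abs_of_nonneg (by positivity : 0 ≤ (n : ℝ) ^ 2), mul_assoc ((n : ℝ) ^ 2)]
  refine mul_le_mul_of_nonneg_left ?_ (by positivity)
  have hV := totalEnergy_nonneg z
  have hz := norm_le_one_add_totalEnergy z
  have h1 : |cutoff R (totalEnergy z) * L (drift γ γ' τ z)| ≤ ‖L‖ * D * (1 + totalEnergy z) := by
    have hd : ‖drift γ γ' τ z‖ ≤ D * (1 + totalEnergy z) := by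
      refine (norm_drift_le γ γ' τ z).trans ?_
      have : |τ| ≤ |τ| * (1 + totalEnergy z) := le_mul_of_one_le_right (abs_nonneg _) (by linarith)
      have := mul_le_mul_of_nonneg_left hz (by positivity : 0 ≤ 2 + 2 * |γ| + 2 * |γ'|)
      rw [hD]; linarith
    rw [abs_mul]
    calc _ ≤ 1 * (‖L‖ * (D * (1 + totalEnergy z))) :=
          mul_le_mul (cutoff_bounds hR z 0).1 ((L.le_opNorm _).trans
            (mul_le_mul_of_nonneg_left hd (norm_nonneg _))) (abs_nonneg _) zero_le_one
      _ = _ := by ring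
  have h2 : |(c + L z) * cutoffTerm γ' τ Tm Tp (cutoffDeriv R) (cutoffDeriv₂ R) z| ≤
      (|c| + ‖L‖) * K * (1 + totalEnergy z) := by
    have hl : |c + L z| ≤ (|c| + ‖L‖) * (1 + totalEnergy z) := by
      refine (abs_add_le _ _).trans ?_
      have h5 := (L.le_opNorm z).trans (mul_le_mul_of_nonneg_left hz (norm_nonneg _))
      rw [Real.norm_eq_abs] at h5
      have : |c| ≤ |c| * (1 + totalEnergy z) := le_mul_of_one_le_right (abs_nonneg _) (by linarith)
      linarith
    rw [abs_mul]
    calc _ ≤ ((|c| + ‖L‖) * (1 + totalEnergy z)) * K :=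
          mul_le_mul hl (abs_cutoffTerm_le γ' τ Tm Tp hR z) (abs_nonneg _) (by positivity)
      _ = _ := by ring
  have h3 : |2 * γ' * cutoffDeriv R (totalEnergy z) * (Tm * L (0, Pi.single 0 1) * z.2 0 +
      Tp * L (0, Pi.single (Fin.last n) 1) * z.2 (Fin.last n))| ≤
      2 * |γ'| * (9 * a + 9 * b) * (1 + totalEnergy z) := by
    have e : 2 * γ' * cutoffDeriv R (totalEnergy z) * (Tm * L (0, Pi.single 0 1) * z.2 0 +
      Tp * L (0, Pi.single (Fin.last n) 1) * z.2 (Fin.last n)) =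
      2 * γ' * ((cutoffDeriv R (totalEnergy z) * z.2 0) * (Tm * L (0, Pi.single 0 1)) +
        (cutoffDeriv R (totalEnergy z) * z.2 (Fin.last n)) *
          (Tp * L (0, Pi.single (Fin.last n) 1))) := by ring
    rw [e, abs_mul, abs_mul, abs_two]
    have h6 := (cutoff_bounds hR z 0).2.2.2.1
    have h7 := (cutoff_bounds hR z (Fin.last n)).2.2.2.1
    refine le_trans ?_ (le_mul_of_one_le_right (by positivity) (by linarith))
    refine mul_le_mul_of_nonneg_left ((abs_add_le _ _).trans ?_) (by positivity)
    rw [abs_mul _ (Tm * _), abs_mul _ (Tp * _), mul_comm 9 a, mul_comm 9 b, mul_comm _ a, mul_comm _ b]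
    exact add_le_add (mul_le_mul_of_nonneg_left h6 (abs_nonneg _))
      (mul_le_mul_of_nonneg_left h7 (abs_nonneg _))
  refine (abs_add_three _ _ _).trans ?_
  linarith

lemma generator_testFunction_eq_zero {R : ℝ} (hR : 0 < R) {z : Config n} (hz : R ≤ totalEnergy z) :
    generator γ γ' τ Tm Tp (testFunction c L (cutoff R)) z = 0 := by
  rw [generator_testFunction c L γ γ' τ Tm Tp (hasDerivAt_cutoff R) (hasDerivAt_cutoffDeriv R) z]
  simp [cutoffTerm, cutoff, cutoffDeriv, cutoffDeriv₂, ramp_eq_zero hR hz]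

lemma exists_abs_generator_le_const {R : ℝ} (hR : 1 ≤ R) : ∃ C : ℝ, ∀ z : Config n,
    |generator γ γ' τ Tm Tp (testFunction c L (cutoff R)) z| ≤ C := by
  obtain ⟨C, hC⟩ := exists_abs_generator_le (n := n) γ γ' τ Tm Tp c L
  refine ⟨|C| * (1 + R), fun z => ?_⟩
  rcases le_or_gt R (totalEnergy z) with h | h
  · rw [generator_testFunction_eq_zero γ γ' τ Tm Tp c L (by linarith) h, abs_zero]
    positivity
  · refine (hC R hR z).trans (mul_le_mul (le_abs_self C) (by linarith) ?_ (abs_nonneg _))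
    linarith [totalEnergy_nonneg z]

lemma continuous_generator_testFunction (R : ℝ) :
    Continuous (generator γ γ' τ Tm Tp (testFunction c L (cutoff R)) : Config n → ℝ) := by
  rw [funext (generator_testFunction c L γ γ' τ Tm Tp (hasDerivAt_cutoff R)
    (hasDerivAt_cutoffDeriv R))]
  have h0 := (continuous_cutoff R).comp (continuous_totalEnergy (n := n))
  have h1 := (continuous_cutoffDeriv R).comp (continuous_totalEnergy (n := n))
  have h2 := (continuous_cutoffDeriv₂ R).comp (continuous_totalEnergy (n := n))
  have h3 := continuous_drift (n := n) γ γ' τ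
  simp only [Function.comp_def] at h0 h1 h2
  unfold cutoffTerm
  fun_prop

lemma tendsto_generator_testFunction (z : Config n) :
    Tendsto (fun m : ℕ => generator γ γ' τ Tm Tp (testFunction c L (cutoff ((m : ℝ) + 1))) z) atTop
      (𝓝 ((n : ℝ) ^ 2 * L (drift γ γ' τ z))) := by
  simp only [fun m : ℕ => generator_testFunction c L γ γ' τ Tm Tp (hasDerivAt_cutoff ((m : ℝ) + 1))
    (hasDerivAt_cutoffDeriv ((m : ℝ) + 1)) z, cutoffTerm]
  have h0 := tendsto_cutoff (totalEnergy z)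
  have h1 := tendsto_cutoffDeriv (totalEnergy z)
  have h2 := tendsto_cutoffDeriv₂ (totalEnergy z)
  have hT : ∀ (T : ℝ) (x : Fin (n + 1)), Tendsto (fun m : ℕ =>
      T * (cutoffDeriv₂ ((m : ℝ) + 1) (totalEnergy z) * z.2 x ^ 2 +
        cutoffDeriv ((m : ℝ) + 1) (totalEnergy z)) -
      cutoffDeriv ((m : ℝ) + 1) (totalEnergy z) * z.2 x ^ 2) atTop (𝓝 0) := fun T x => by
    simpa using (((h2.mul_const (z.2 x ^ 2)).add h1).const_mul T).sub (h1.mul_const (z.2 x ^ 2))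
  have h3 := (h1.mul_const (τ * z.2 (Fin.last n))).add
    (((hT Tm 0).add (hT Tp (Fin.last n))).const_mul γ')
  have h4 := (((h0.mul_const (L (drift γ γ' τ z))).add (h3.const_mul (c + L z))).add
    ((h1.const_mul (2 * γ')).mul_const (Tm * L (0, Pi.single 0 1) * z.2 0 +
          Tp * L (0, Pi.single (Fin.last n) 1) * z.2 (Fin.last n)))).const_mul ((n : ℝ) ^ 2)
  simpa using h4

/-- The Lyapunov bound: up to truncation, the generator applied to the energy is bounded. -/
lemma generator_cutoff_ge (hγ' : 0 < γ') (hTm : 0 < Tm) (hTp : 0 < Tp) {R : ℝ} (hR : 0 < R)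
    (z : Config n) :
    -(3 / R) * ((n : ℝ) ^ 2 * (τ ^ 2 / (4 * γ') + γ' * (Tm + Tp))) ≤
      generator γ γ' τ Tm Tp (testFunction 1 0 (cutoff R)) z := by
  -- With `c = 1` and `L = 0` the test function is the cutoff itself. The truncated energy is `(R /
  -- 3)(1 - cutoff)`, so a lower bound here is an upper bound for its growth.
  rw [generator_testFunction 1 0 γ γ' τ Tm Tp (hasDerivAt_cutoff R) (hasDerivAt_cutoffDeriv R) z,
    mul_left_comm]
  refine mul_le_mul_of_nonneg_left ?_ (by positivity)
  have h0 := ramp_nonneg R (totalEnergy z)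
  have h1 := ramp_le_one hR (totalEnergy_nonneg z)
  have h2 : 0 ≤ cutoffDeriv₂ R (totalEnergy z) := mul_nonneg (by positivity) h0
  have h3 : cutoffDeriv R (totalEnergy z) ≤ 0 :=
    mul_nonpos_of_nonpos_of_nonneg (neg_nonpos.2 (by positivity)) (by positivity)
  have h4 : -(3 / R) ≤ cutoffDeriv R (totalEnergy z) := by
    have h5 : ramp R (totalEnergy z) ^ 2 ≤ 1 := pow_le_one₀ h0 h1
    have h6 : 0 < 3 / R := by positivity
    rw [cutoffDeriv]; nlinarith
  have hC : 0 ≤ τ ^ 2 / (4 * γ') + γ' * (Tm + Tp) := by positivity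
  -- Completing the square: the friction of the right thermostat absorbs the work of the tension.
  have hq : τ * z.2 (Fin.last n) ≤ τ ^ 2 / (4 * γ') + γ' * z.2 (Fin.last n) ^ 2 := by
    have : τ ^ 2 / (4 * γ') + γ' * z.2 (Fin.last n) ^ 2 - τ * z.2 (Fin.last n) =
      (τ - 2 * γ' * z.2 (Fin.last n)) ^ 2 / (4 * γ') := by field_simp; ring
    have h7 : 0 ≤ (τ - 2 * γ' * z.2 (Fin.last n)) ^ 2 / (4 * γ') := by positivity
    linarith
  have hb : τ * z.2 (Fin.last n) - γ' * z.2 (Fin.last n) ^ 2 - γ' * z.2 0 ^ 2 + γ' * (Tm + Tp) ≤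
      τ ^ 2 / (4 * γ') + γ' * (Tm + Tp) := by
    have : 0 ≤ γ' * z.2 0 ^ 2 := by positivity
    linarith
  set d := cutoffDeriv R (totalEnergy z)
  set e := cutoffDeriv₂ R (totalEnergy z)
  -- The cutoff is convex, so its second-derivative terms have the favourable sign.
  have h8 : 0 ≤ γ' * (Tm * (e * z.2 0 ^ 2) + Tp * (e * z.2 (Fin.last n) ^ 2)) := by positivity
  calc -(3 / R) * (τ ^ 2 / (4 * γ') + γ' * (Tm + Tp))
      ≤ d * (τ ^ 2 / (4 * γ') + γ' * (Tm + Tp)) := mul_le_mul_of_nonneg_right h4 hC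
    _ ≤ d * (τ * z.2 (Fin.last n) - γ' * z.2 (Fin.last n) ^ 2 - γ' * z.2 0 ^ 2 +
          γ' * (Tm + Tp)) := mul_le_mul_of_nonpos_left hb h3
    _ ≤ d * (τ * z.2 (Fin.last n) - γ' * z.2 (Fin.last n) ^ 2 - γ' * z.2 0 ^ 2 +
          γ' * (Tm + Tp)) +
        γ' * (Tm * (e * z.2 0 ^ 2) + Tp * (e * z.2 (Fin.last n) ^ 2)) := le_add_of_nonneg_right h8
    _ = _ := by simp [cutoffTerm, d, e]; ring

end GeneratorBounds

/-! ### Dynkin's formula, moment bounds and removal of the cutoff -/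

section Dynkin

/-- Discretization of time from above, on the grid of mesh `1 / (m + 1)`. -/
def gridAbove (m : ℕ) (t : ℝ≥0) : ℝ≥0 := ((⌊t * (m + 1)⌋₊ : ℝ≥0) + 1) / (m + 1)

lemma le_gridAbove (m : ℕ) (t : ℝ≥0) : t ≤ gridAbove m t := by
  rw [gridAbove, le_div_iff₀ (by positivity)]
  exact (Nat.lt_floor_add_one _).le

lemma gridAbove_le (m : ℕ) (t : ℝ≥0) : gridAbove m t ≤ t + 1 / ((m : ℝ≥0) + 1) := by
  rw [gridAbove, div_le_iff₀ (by positivity), add_mul, one_div, inv_mul_cancel₀ (by positivity)]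
  gcongr
  exact Nat.floor_le zero_le

lemma tendsto_gridAbove (t : ℝ≥0) :
    Tendsto (fun m => gridAbove m t) atTop (𝓝[Set.Ici t] t) := by
  refine tendsto_nhdsWithin_iff.2 ⟨?_, Eventually.of_forall fun m => le_gridAbove m t⟩
  refine tendsto_of_tendsto_of_tendsto_of_le_of_le tendsto_const_nhds ?_
    (fun m => le_gridAbove m t) (fun m => gridAbove_le m t)
  have h : Tendsto (fun m : ℕ => (1 : ℝ≥0) / ((m : ℝ≥0) + 1)) atTop (𝓝 0) :=
    tendsto_one_div_add_atTop_nhds_zero_nat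
  simpa using h.const_add t

variable {Ω : Type*} [MeasurableSpace Ω]

/-- A right-continuous process with measurable marginals is jointly measurable. -/
lemma measurable_uncurry_of_rightContinuous {E : Type*} [TopologicalSpace E]
    [TopologicalSpace.PseudoMetrizableSpace E] [MeasurableSpace E] [BorelSpace E]
    {Y : ℝ≥0 → Ω → E} (hm : ∀ t, Measurable (Y t))
    (hc : ∀ ω t, ContinuousWithinAt (fun s => Y s ω) (Set.Ici t) t) :
    Measurable (Function.uncurry Y) := by
  -- Sampling the process on the grid factors through the countable index `⌊t (m + 1)⌋₊`; the grid
  -- lies above `t`, so right continuity gives the limit.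
  have h1 : ∀ m : ℕ, Measurable fun q : ℕ × Ω => Y (((q.1 : ℝ≥0) + 1) / (m + 1)) q.2 := fun m =>
    measurable_from_prod_countable_right fun k => hm (((k : ℝ≥0) + 1) / (m + 1))
  have h2 : ∀ m : ℕ, Measurable fun q : ℝ≥0 × Ω => (⌊q.1 * (m + 1)⌋₊, q.2) := fun m =>
    (Nat.measurable_floor.comp (measurable_fst.mul_const _)).prodMk measurable_snd
  have h3 : ∀ q : ℝ≥0 × Ω, Tendsto (fun m => Y (gridAbove m q.1) q.2) atTop (𝓝 (Y q.1 q.2)) :=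
    fun q => (hc q.2 q.1).tendsto.comp (tendsto_gridAbove q.1)
  exact measurable_of_tendsto_metrizable (fun m => (h1 m).comp (h2 m)) (tendsto_pi_nhds.2 h3)

variable {P : Measure Ω} {X : ℝ≥0 → Ω → Config n} {γ γ' τ Tm Tp : ℝ}

namespace IsChainProcess

lemma measurable (h : IsChainProcess γ γ' τ Tm Tp P X) (t : ℝ≥0) : Measurable (X t) := by
  obtain ⟨𝓕, hA, -⟩ := h.martingale_problem
  exact (hA t).mono (𝓕.le t) le_rfl

lemma measurable_uncurry (h : IsChainProcess γ γ' τ Tm Tp P X) :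
    Measurable fun q : ℝ × Ω => X q.1.toNNReal q.2 :=
  (measurable_uncurry_of_rightContinuous h.measurable h.right_continuous).comp
    ((measurable_real_toNNReal.comp measurable_fst).prodMk measurable_snd)

lemma stronglyMeasurable_integral (h : IsChainProcess γ γ' τ Tm Tp P X) {G : Config n → ℝ}
    (hG : Continuous G) : StronglyMeasurable fun s : ℝ => ∫ ω, G (X s.toNNReal ω) ∂P := by
  have := h.isProbabilityMeasure
  exact StronglyMeasurable.integral_prod_right (f := fun s ω => G (X (Real.toNNReal s) ω))
    (hG.measurable.comp h.measurable_uncurry).stronglyMeasurable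

/-- Dynkin's formula. -/
lemma integral_eq_add (h : IsChainProcess γ γ' τ Tm Tp P X) {F : Config n → ℝ}
    (hF : ContDiff ℝ 2 F) (hF' : HasCompactSupport F)
    (hG : Continuous (generator γ γ' τ Tm Tp F))
    (hG' : ∃ C : ℝ, ∀ z, |generator γ γ' τ Tm Tp F z| ≤ C) (t : ℝ≥0) :
    ∫ ω, F (X t ω) ∂P = ∫ ω, F (X 0 ω) ∂P +
      ∫ s in (0 : ℝ)..t, ∫ ω, generator γ γ' τ Tm Tp F (X s.toNNReal ω) ∂P := by
  have := h.isProbabilityMeasure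
  obtain ⟨C, hC⟩ := hG'
  obtain ⟨𝓕, -, hM⟩ := h.martingale_problem
  have hM := hM F hF hF'
  have hFi : Integrable (fun ω => F (X t ω)) P := by
    obtain ⟨K, hK⟩ := hF.continuous.bounded_above_of_compact_support hF'
    exact Integrable.of_bound (hF.continuous.measurable.comp (h.measurable t)).aestronglyMeasurable
      K (Eventually.of_forall fun ω => hK _)
  -- The time integral is the difference of two integrable variables, `F (X t)` and the martingale.
  have hIi : Integrable (fun ω => ∫ s in (0 : ℝ)..t, generator γ γ' τ Tm Tp F (X s.toNNReal ω)) P := by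
    refine (hFi.sub (hM.integrable t)).congr (Eventually.of_forall fun ω => ?_)
    simp
  have hE := hM.setIntegral_eq (zero_le : 0 ≤ t) MeasurableSet.univ
  simp only [Measure.restrict_univ, NNReal.coe_zero, intervalIntegral.integral_same, sub_zero] at hE
  rw [integral_sub hFi hIi] at hE
  have hprod : Integrable (Function.uncurry fun (s : ℝ) (ω : Ω) =>
      generator γ γ' τ Tm Tp F (X s.toNNReal ω)) ((volume.restrict (Set.Ioc (0 : ℝ) t)).prod P) :=
    Integrable.of_bound (hG.measurable.comp h.measurable_uncurry).aestronglyMeasurable C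
      (Eventually.of_forall fun q => hC _)
  have hswap := integral_integral_swap hprod
  rw [intervalIntegral.integral_of_le t.coe_nonneg, hswap]
  simp only [intervalIntegral.integral_of_le t.coe_nonneg] at hE
  linarith

/-- The mean energy grows at most linearly in time. -/
lemma lintegral_totalEnergy_le (h : IsChainProcess γ γ' τ Tm Tp P X) (hγ' : 0 < γ')
    (hTm : 0 < Tm) (hTp : 0 < Tp) (h0 : Integrable (fun ω => totalEnergy (X 0 ω)) P) (t : ℝ≥0) :
    ∫⁻ ω, ENNReal.ofReal (totalEnergy (X t ω)) ∂P ≤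
      ENNReal.ofReal (∫ ω, totalEnergy (X 0 ω) ∂P +
        t * ((n : ℝ) ^ 2 * (τ ^ 2 / (4 * γ') + γ' * (Tm + Tp)))) := by
  have := h.isProbabilityMeasure
  set C := (n : ℝ) ^ 2 * (τ ^ 2 / (4 * γ') + γ' * (Tm + Tp)) with hC
  have hmV : ∀ t, Measurable fun ω => totalEnergy (X t ω) := fun t =>
    continuous_totalEnergy.measurable.comp (h.measurable t)
  have hmc : ∀ R t, Measurable fun ω => cutoff R (totalEnergy (X t ω)) := fun R t =>
    (continuous_cutoff R).measurable.comp (hmV t)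
  have hic : ∀ R, 1 ≤ R → ∀ t, Integrable (fun ω => cutoff R (totalEnergy (X t ω))) P :=
    fun R hR t => Integrable.of_bound (hmc R t).aestronglyMeasurable 1
      (Eventually.of_forall fun ω => (cutoff_bounds hR (X t ω) 0).1)
  have hig : ∀ R, 1 ≤ R → ∀ t,
      Integrable (fun ω => R / 3 * (1 - cutoff R (totalEnergy (X t ω)))) P :=
    fun R hR t => ((integrable_const 1).sub (hic R hR t)).const_mul _
  have hbound : ∀ R : ℝ, 1 ≤ R →
      ∫ ω, R / 3 * (1 - cutoff R (totalEnergy (X t ω))) ∂P ≤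
        ∫ ω, totalEnergy (X 0 ω) ∂P + t * C := fun R hR => by
    have hR0 : 0 < R := by linarith
    have hD := h.integral_eq_add (contDiff_testFunction 1 0 R)
      (hasCompactSupport_testFunction 1 0 hR0)
      (continuous_generator_testFunction γ γ' τ Tm Tp 1 0 R)
      (exists_abs_generator_le_const γ γ' τ Tm Tp 1 0 hR) t
    simp only [testFunction, zero_apply, add_zero, one_mul] at hD
    obtain ⟨K, hK⟩ := exists_abs_generator_le_const (n := n) γ γ' τ Tm Tp 1 0 hR
    have hKi : ∀ s : ℝ, Integrable (fun ω => generator γ γ' τ Tm Tp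
        (testFunction 1 0 (cutoff R)) (X s.toNNReal ω)) P := fun s =>
      Integrable.of_bound ((continuous_generator_testFunction γ γ' τ Tm Tp 1 0 R).measurable.comp
        (h.measurable _)).aestronglyMeasurable K (Eventually.of_forall fun ω => hK _)
    have hlow : ∫ s in (0 : ℝ)..t, -(3 / R) * C ≤ ∫ s in (0 : ℝ)..t, ∫ ω, generator γ γ' τ Tm Tp
        (testFunction 1 0 (cutoff R)) (X s.toNNReal ω) ∂P := by
      refine intervalIntegral.integral_mono_on t.coe_nonneg intervalIntegrable_const ?_ fun s _ => ?_
      · rw [intervalIntegrable_iff_integrableOn_Ioc_of_le t.coe_nonneg]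
        refine Integrable.of_bound (h.stronglyMeasurable_integral
          (continuous_generator_testFunction γ γ' τ Tm Tp 1 0 R)).aestronglyMeasurable K
          (Eventually.of_forall fun s => ?_)
        have := norm_integral_le_of_norm_le_const (μ := P) (C := K)
          (f := fun ω => generator γ γ' τ Tm Tp (testFunction 1 0 (cutoff R)) (X s.toNNReal ω))
          (Eventually.of_forall fun ω => hK (X s.toNNReal ω))
        simpa using this
      · have := integral_mono (integrable_const (-(3 / R) * C)) (hKi s) fun ω =>
          generator_cutoff_ge γ γ' τ Tm Tp hγ' hTm hTp hR0 (X s.toNNReal ω)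
        simpa using this
    rw [intervalIntegral.integral_const, smul_eq_mul, sub_zero] at hlow
    have e : ∀ t, ∫ ω, R / 3 * (1 - cutoff R (totalEnergy (X t ω))) ∂P =
        R / 3 * (1 - ∫ ω, cutoff R (totalEnergy (X t ω)) ∂P) := fun t => by
      rw [integral_const_mul, integral_sub (integrable_const 1) (hic R hR t)]
      simp
    have h1 : ∫ ω, R / 3 * (1 - cutoff R (totalEnergy (X 0 ω))) ∂P ≤
        ∫ ω, totalEnergy (X 0 ω) ∂P :=
      integral_mono (hig R hR 0) h0 fun ω => (truncation_bounds hR0 (totalEnergy_nonneg _)).2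
    have h2 : R / 3 * (1 - ∫ ω, cutoff R (totalEnergy (X t ω)) ∂P) ≤
        R / 3 * (1 - (∫ ω, cutoff R (totalEnergy (X 0 ω)) ∂P + t * (-(3 / R) * C))) := by
      refine mul_le_mul_of_nonneg_left ?_ (by positivity)
      linarith
    -- The factors `R / 3` and `3 / R` cancel, so the growth `t * C` is free of `R`.
    have h3 : R / 3 * (1 - (∫ ω, cutoff R (totalEnergy (X 0 ω)) ∂P + t * (-(3 / R) * C))) =
        R / 3 * (1 - ∫ ω, cutoff R (totalEnergy (X 0 ω)) ∂P) + t * C := by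
      field_simp
      ring
    rw [e] at h1 ⊢
    linarith
  have hlim : ∀ ω, liminf (fun m : ℕ => ENNReal.ofReal (((m : ℝ) + 1) / 3 *
      (1 - cutoff ((m : ℝ) + 1) (totalEnergy (X t ω))))) atTop =
        ENNReal.ofReal (totalEnergy (X t ω)) := fun ω =>
    ((ENNReal.continuous_ofReal.tendsto _).comp (tendsto_truncation (totalEnergy (X t ω)))).liminf_eq
  -- Fatou's lemma along `R = m + 1`: integrability of the energy at time `t` is a conclusion here,
  -- so dominated convergence is not available.
  calc ∫⁻ ω, ENNReal.ofReal (totalEnergy (X t ω)) ∂P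
      = ∫⁻ ω, liminf (fun m : ℕ => ENNReal.ofReal (((m : ℝ) + 1) / 3 *
          (1 - cutoff ((m : ℝ) + 1) (totalEnergy (X t ω))))) atTop ∂P := by simp only [hlim]
    _ ≤ liminf (fun m : ℕ => ∫⁻ ω, ENNReal.ofReal (((m : ℝ) + 1) / 3 *
          (1 - cutoff ((m : ℝ) + 1) (totalEnergy (X t ω)))) ∂P) atTop :=
        lintegral_liminf_le fun m =>
          (((hmc _ t).const_sub 1).const_mul _).ennreal_ofReal
    _ ≤ _ := by
        refine liminf_le_of_le (by isBoundedDefault) fun b hb => ?_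
        obtain ⟨m, hm⟩ := hb.exists
        refine hm.trans ?_
        have hR : (1 : ℝ) ≤ (m : ℝ) + 1 := by simp
        rw [← ofReal_integral_eq_lintegral_ofReal (hig _ hR t)
          (Eventually.of_forall fun ω => (truncation_bounds (by linarith) (totalEnergy_nonneg _)).1)]
        exact ENNReal.ofReal_le_ofReal (hbound _ hR)

lemma integrable_totalEnergy (h : IsChainProcess γ γ' τ Tm Tp P X) (hγ' : 0 < γ')
    (hTm : 0 < Tm) (hTp : 0 < Tp) (h0 : Integrable (fun ω => totalEnergy (X 0 ω)) P) (t : ℝ≥0) :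
    Integrable (fun ω => totalEnergy (X t ω)) P := by
  refine ⟨(continuous_totalEnergy.measurable.comp (h.measurable t)).aestronglyMeasurable, ?_⟩
  rw [hasFiniteIntegral_iff_ofReal (Eventually.of_forall fun ω => totalEnergy_nonneg _)]
  exact (h.lintegral_totalEnergy_le hγ' hTm hTp h0 t).trans_lt ENNReal.ofReal_lt_top

lemma integral_totalEnergy_le (h : IsChainProcess γ γ' τ Tm Tp P X) (hγ' : 0 < γ')
    (hTm : 0 < Tm) (hTp : 0 < Tp) (h0 : Integrable (fun ω => totalEnergy (X 0 ω)) P) (t : ℝ≥0) :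
    ∫ ω, totalEnergy (X t ω) ∂P ≤ ∫ ω, totalEnergy (X 0 ω) ∂P +
        t * ((n : ℝ) ^ 2 * (τ ^ 2 / (4 * γ') + γ' * (Tm + Tp))) := by
  have h1 := h.lintegral_totalEnergy_le hγ' hTm hTp h0 t
  rw [← ofReal_integral_eq_lintegral_ofReal (h.integrable_totalEnergy hγ' hTm hTp h0 t)
    (Eventually.of_forall fun ω => totalEnergy_nonneg _)] at h1
  refine (ENNReal.ofReal_le_ofReal_iff ?_).1 h1
  have : 0 ≤ ∫ ω, totalEnergy (X 0 ω) ∂P := integral_nonneg fun ω => totalEnergy_nonneg (X 0 ω)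
  positivity

lemma integrable_config (h : IsChainProcess γ γ' τ Tm Tp P X) (hγ' : 0 < γ')
    (hTm : 0 < Tm) (hTp : 0 < Tp) (h0 : Integrable (fun ω => totalEnergy (X 0 ω)) P) (t : ℝ≥0) :
    Integrable (X t) P := by
  have := h.isProbabilityMeasure
  refine ((integrable_const (1 : ℝ)).add (h.integrable_totalEnergy hγ' hTm hTp h0 t)).mono'
    (h.measurable t).aestronglyMeasurable (Eventually.of_forall fun ω => ?_)
  exact norm_le_one_add_totalEnergy _

/-- The evolution equation of the means, in integrated form. -/
lemma integral_config_eq (h : IsChainProcess γ γ' τ Tm Tp P X) (hγ' : 0 < γ')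
    (hTm : 0 < Tm) (hTp : 0 < Tp) (h0 : Integrable (fun ω => totalEnergy (X 0 ω)) P)
    (L : Config n →L[ℝ] ℝ) (t : ℝ≥0) :
    IntervalIntegrable (fun s : ℝ => (n : ℝ) ^ 2 * ∫ ω, L (drift γ γ' τ (X s.toNNReal ω)) ∂P)
      volume 0 t ∧
    ∫ ω, L (X t ω) ∂P = ∫ ω, L (X 0 ω) ∂P +
      ∫ s in (0 : ℝ)..t, (n : ℝ) ^ 2 * ∫ ω, L (drift γ γ' τ (X s.toNNReal ω)) ∂P := by
  have := h.isProbabilityMeasure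
  obtain ⟨C, hC⟩ := exists_abs_generator_le (n := n) γ γ' τ Tm Tp 0 L
  have hR : ∀ m : ℕ, (1 : ℝ) ≤ (m : ℝ) + 1 := fun m => by simp
  have hV : ∀ t, Integrable (fun ω => 1 + totalEnergy (X t ω)) P := fun t =>
    (integrable_const (1 : ℝ)).add (h.integrable_totalEnergy hγ' hTm hTp h0 t)
  set E0 := ∫ ω, totalEnergy (X 0 ω) ∂P
  set C0 := (n : ℝ) ^ 2 * (τ ^ 2 / (4 * γ') + γ' * (Tm + Tp))
  have hC0 : 0 ≤ C0 := by positivity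
  have hEV : ∀ s ∈ Set.Ioc (0 : ℝ) t,
      ∫ ω, (1 + totalEnergy (X s.toNNReal ω)) ∂P ≤ 1 + (E0 + t * C0) := fun s hs => by
    rw [integral_add (integrable_const _) (h.integrable_totalEnergy hγ' hTm hTp h0 _)]
    have h1 := h.integral_totalEnergy_le hγ' hTm hTp h0 s.toNNReal
    have h2 : (s.toNNReal : ℝ) * C0 ≤ t * C0 := by
      rw [Real.coe_toNNReal s hs.1.le]; exact mul_le_mul_of_nonneg_right hs.2 hC0
    simp only [integral_const, probReal_univ, smul_eq_mul, mul_one]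
    linarith
  have hlimF : ∀ t, Tendsto (fun m : ℕ => ∫ ω, testFunction 0 L (cutoff ((m : ℝ) + 1)) (X t ω) ∂P)
      atTop (𝓝 (∫ ω, L (X t ω) ∂P)) := fun t => by
    refine tendsto_integral_of_dominated_convergence (fun ω => ‖L‖ * (1 + totalEnergy (X t ω)))
      (fun m => ((contDiff_testFunction 0 L _).continuous.measurable.comp
        (h.measurable t)).aestronglyMeasurable) ((hV t).const_mul _)
      (fun m => Eventually.of_forall fun ω => ?_) (Eventually.of_forall fun ω => ?_)
    · rw [testFunction, zero_add, norm_mul]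
      refine (mul_le_of_le_one_right (norm_nonneg _) (cutoff_bounds (hR m) _ 0).1).trans ?_
      exact (L.le_opNorm _).trans
        (mul_le_mul_of_nonneg_left (norm_le_one_add_totalEnergy _) (norm_nonneg _))
    · simpa [testFunction] using (tendsto_cutoff (totalEnergy (X t ω))).const_mul (L (X t ω))
  have hlimG : ∀ t, Tendsto (fun m : ℕ => ∫ ω, generator γ γ' τ Tm Tp
      (testFunction 0 L (cutoff ((m : ℝ) + 1))) (X t ω) ∂P)
      atTop (𝓝 (∫ ω, (n : ℝ) ^ 2 * L (drift γ γ' τ (X t ω)) ∂P)) := fun t =>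
    tendsto_integral_of_dominated_convergence (fun ω => C * (1 + totalEnergy (X t ω)))
      (fun m => ((continuous_generator_testFunction γ γ' τ Tm Tp 0 L _).measurable.comp
        (h.measurable t)).aestronglyMeasurable) ((hV t).const_mul _)
      (fun m => Eventually.of_forall fun ω => hC _ (hR m) _)
      (Eventually.of_forall fun ω => tendsto_generator_testFunction γ γ' τ Tm Tp 0 L _)
  have hGb : ∀ m : ℕ, ∀ s ∈ Set.Ioc (0 : ℝ) t, ‖∫ ω, generator γ γ' τ Tm Tp
      (testFunction 0 L (cutoff ((m : ℝ) + 1))) (X s.toNNReal ω) ∂P‖ ≤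
        |C| * (1 + (E0 + t * C0)) := fun m s hs => by
    refine (norm_integral_le_of_norm_le ((hV s.toNNReal).const_mul |C|)
      (Eventually.of_forall fun ω => (hC _ (hR m) _).trans ?_)).trans ?_
    · exact mul_le_mul_of_nonneg_right (le_abs_self C)
        (by linarith [totalEnergy_nonneg (X s.toNNReal ω)])
    · rw [integral_const_mul]
      exact mul_le_mul_of_nonneg_left (hEV s hs) (abs_nonneg _)
  simp only [integral_const_mul] at hlimG
  have hint : IntervalIntegrable (fun s : ℝ => (n : ℝ) ^ 2 *
      ∫ ω, L (drift γ γ' τ (X s.toNNReal ω)) ∂P) volume 0 t := by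
    rw [intervalIntegrable_iff_integrableOn_Ioc_of_le t.coe_nonneg]
    refine Integrable.of_bound ((h.stronglyMeasurable_integral
      (L.continuous.comp (continuous_drift γ γ' τ))).aestronglyMeasurable.const_mul _)
      (|C| * (1 + (E0 + t * C0))) ?_
    filter_upwards [ae_restrict_mem measurableSet_Ioc] with s hs
    exact le_of_tendsto (hlimG s.toNNReal).norm (Eventually.of_forall fun m => hGb m s hs)
  have hD := fun m : ℕ => h.integral_eq_add (contDiff_testFunction 0 L ((m : ℝ) + 1))
      (hasCompactSupport_testFunction 0 L (by positivity))
      (continuous_generator_testFunction γ γ' τ Tm Tp 0 L _)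
      (exists_abs_generator_le_const γ γ' τ Tm Tp 0 L (hR m)) t
  -- A second dominated convergence, now in time; `hEV` makes the bound uniform on `(0, t]`.
  have hlimI := intervalIntegral.tendsto_integral_filter_of_dominated_convergence
    (μ := volume) (a := 0) (b := t) (l := atTop) (F := fun (m : ℕ) (s : ℝ) =>
      ∫ ω, generator γ γ' τ Tm Tp (testFunction 0 L (cutoff ((m : ℝ) + 1))) (X s.toNNReal ω) ∂P)
    (f := fun s : ℝ => (n : ℝ) ^ 2 * ∫ ω, L (drift γ γ' τ (X s.toNNReal ω)) ∂P)
    (fun _ => |C| * (1 + (E0 + t * C0)))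
    (Eventually.of_forall fun m => (h.stronglyMeasurable_integral
      (continuous_generator_testFunction γ γ' τ Tm Tp 0 L _)).aestronglyMeasurable)
    (Eventually.of_forall fun m => Eventually.of_forall fun s hs =>
      hGb m s (by rwa [Set.uIoc_of_le t.coe_nonneg] at hs))
    intervalIntegrable_const (Eventually.of_forall fun s _ => hlimG s.toNNReal)
  refine ⟨hint, tendsto_nhds_unique (hlimF t) ?_⟩
  simp only [hD]
  exact (hlimF 0).add hlimI

end IsChainProcess

end Dynkin

/-! ### The linear equation of the means: stationary solution and energy balance -/

section LinearFlow

lemma rightTension_add (a b : ℝ) (z w : Config n) (x : Fin (n + 1)) :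
    rightTension (a + b) (z + w) x = rightTension a z x + rightTension b w x := by
  refine Fin.lastCases ?_ (fun i => ?_) x <;> simp [rightTension]

lemma rightTension_smul (a b : ℝ) (z : Config n) (x : Fin (n + 1)) :
    rightTension (a * b) (a • z) x = a * rightTension b z x := by
  refine Fin.lastCases ?_ (fun i => ?_) x <;> simp [rightTension]

lemma stretch_add (z w : Config n) (x : Fin (n + 1)) :
    stretch (z + w) x = stretch z x + stretch w x := by
  refine Fin.cases ?_ (fun i => ?_) x <;> simp [stretch]

lemma stretch_smul (a : ℝ) (z : Config n) (x : Fin (n + 1)) :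
    stretch (a • z) x = a * stretch z x := by
  refine Fin.cases ?_ (fun i => ?_) x <;> simp [stretch]

variable (γ γ' τ : ℝ)

lemma drift_fst (z : Config n) (i : Fin n) :
    (drift γ γ' τ z).1 i = z.2 i.succ - z.2 i.castSucc := by
  simp [drift, hamiltonianField]

lemma drift_snd (z : Config n) (x : Fin (n + 1)) :
    (drift γ γ' τ z).2 x = rightTension τ z x - stretch z x - 2 * γ * z.2 x -
      γ' * z.2 0 * (Pi.single 0 1 : Fin (n + 1) → ℝ) x -
      γ' * z.2 (Fin.last n) * (Pi.single (Fin.last n) 1 : Fin (n + 1) → ℝ) x := by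
  simp [drift, hamiltonianField]

/-- The drift is linear in the pair (tension, configuration); hence subtracting a stationary
solution at tension `τ` leaves the equation at tension `0`. -/
lemma drift_add (a b : ℝ) (z w : Config n) :
    drift γ γ' (a + b) (z + w) = drift γ γ' a z + drift γ γ' b w := by
  ext x
  · simp only [Prod.fst_add, Prod.snd_add, Pi.add_apply, drift_fst]; ring
  · simp only [Prod.snd_add, Pi.add_apply, drift_snd, rightTension_add, stretch_add]; ring

lemma drift_smul (a b : ℝ) (z : Config n) :
    drift γ γ' (a * b) (a • z) = a • drift γ γ' b z := by
  ext x
  · simp only [Prod.smul_fst, Prod.smul_snd, Pi.smul_apply, drift_fst, smul_eq_mul]; ring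
  · simp only [Prod.smul_snd, Pi.smul_apply, drift_snd, rightTension_smul, stretch_smul,
      smul_eq_mul]
    ring

/-- The drift at zero external tension, as a linear map. -/
def driftLinear : Config n →ₗ[ℝ] Config n where
  toFun := drift γ γ' 0
  map_add' z w := by simpa using drift_add γ γ' 0 0 z w
  map_smul' a z := by simpa using drift_smul γ γ' a 0 z

lemma drift_eq_add (z : Config n) : drift γ γ' τ z = drift γ γ' 0 z + drift γ γ' τ 0 := by
  simpa using drift_add γ γ' 0 τ z 0

/-- The drift commutes with taking means. -/
lemma integral_drift {Ω : Type*} [MeasurableSpace Ω] {P : Measure Ω} [IsProbabilityMeasure P]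
    {Z : Ω → Config n} (hZ : Integrable Z P) (L : Config n →L[ℝ] ℝ) :
    ∫ ω, L (drift γ γ' τ (Z ω)) ∂P = L (drift γ γ' τ (∫ ω, Z ω ∂P)) := by
  let M : Config n →L[ℝ] ℝ := L.comp (LinearMap.toContinuousLinearMap (driftLinear γ γ'))
  have hM : ∀ z, L (drift γ γ' τ z) = M z + L (drift γ γ' τ 0) := fun z => by
    rw [drift_eq_add, map_add]; rfl
  rw [integral_congr_ae (Eventually.of_forall fun ω => hM (Z ω)), hM (∫ ω, Z ω ∂P),
    integral_add (M.integrable_comp hZ) (integrable_const _), M.integral_comp_comm hZ]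
  simp

/-- The velocity of the stationary solution of the equations of the means. -/
def stationaryVelocity (n : ℕ) : ℝ := τ / (2 * γ * ((n : ℝ) + 1) + 2 * γ')

/-- The stationary solution of the equations of the means. -/
def stationaryConfig (n : ℕ) : Config n :=
  (fun i => (2 * γ * ((i : ℝ) + 1) + γ') * stationaryVelocity γ γ' τ n,
    fun _ => stationaryVelocity γ γ' τ n)

variable {γ γ'}

/-- Constant stretches in time force one common velocity `v`. The tension then increases by `2γ v`
at each site, plus `γ' v` at each end, and must reach `τ` at the right, which determines `v`. -/
lemma drift_stationaryConfig (hγ : 0 < γ) (hγ' : 0 < γ') :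
    drift γ γ' τ (stationaryConfig γ γ' τ n) = 0 := by
  set v := stationaryVelocity γ γ' τ n with hv
  have hτ : τ = (2 * γ * ((n : ℝ) + 1) + 2 * γ') * v := by
    have : 0 < 2 * γ * ((n : ℝ) + 1) + 2 * γ' := by positivity
    rw [hv, stationaryVelocity, mul_div_cancel₀ _ this.ne']
  -- The bulk formulas for both tensions are extended to all sites; the corrections at the ends
  -- cancel the thermostat frictions.
  have hr : ∀ x, rightTension τ (stationaryConfig γ γ' τ n) x =
      (2 * γ * ((x : ℕ) + 1 : ℝ) + γ') * v +
        γ' * v * (Pi.single (Fin.last n) 1 : Fin (n + 1) → ℝ) x := fun x => by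
    refine Fin.lastCases ?_ (fun i => ?_) x
    · simp only [rightTension, Fin.snoc_last, Fin.val_last, Pi.single_eq_same]
      linear_combination hτ
    · simp [rightTension, stationaryConfig, (Fin.castSucc_lt_last i).ne, ← hv]
  have hs : ∀ x, stretch (stationaryConfig γ γ' τ n) x =
      (2 * γ * (x : ℕ) + γ') * v - γ' * v * (Pi.single 0 1 : Fin (n + 1) → ℝ) x := fun x => by
    refine Fin.cases ?_ (fun i => ?_) x
    · simp [stretch]
    · simp [stretch, stationaryConfig, ← hv]
  ext x
  · simp [drift_fst, stationaryConfig]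
  · rw [drift_snd, hr, hs]
    simp only [stationaryConfig, ← hv, Prod.snd_zero, Pi.zero_apply]
    ring

lemma sq_stationaryVelocity_le (hγ : 0 < γ) (hγ' : 0 < γ') :
    ((n : ℝ) + 1) * stationaryVelocity γ γ' τ n ^ 2 ≤ τ ^ 2 / (4 * γ ^ 2 * ((n : ℝ) + 1)) := by
  have h0 : 0 < 2 * γ * ((n : ℝ) + 1) := by positivity
  calc ((n : ℝ) + 1) * stationaryVelocity γ γ' τ n ^ 2
      = ((n : ℝ) + 1) * (τ ^ 2 / (2 * γ * ((n : ℝ) + 1) + 2 * γ') ^ 2) := by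
        rw [stationaryVelocity, div_pow]
    _ ≤ ((n : ℝ) + 1) * (τ ^ 2 / (2 * γ * ((n : ℝ) + 1)) ^ 2) := by
        gcongr
        linarith
    _ = _ := by field_simp; ring

/-- Each stretch is a fraction of `τ` with coefficient in `[0, 1]`; the momenta contribute only
`O(1/n)`. -/
lemma totalEnergy_stationaryConfig_le (hγ : 0 < γ) (hγ' : 0 < γ') :
    totalEnergy (stationaryConfig γ γ' τ n) ≤
      (τ ^ 2 / 2 + τ ^ 2 / (8 * γ ^ 2)) * ((n : ℝ) + 1) := by
  have h1 : ∀ i : Fin n, (stationaryConfig γ γ' τ n).1 i ^ 2 ≤ τ ^ 2 := fun i => by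
    have hi : (i : ℝ) + 1 ≤ n := by exact_mod_cast i.2
    have hD : 0 < 2 * γ * ((n : ℝ) + 1) + 2 * γ' := by positivity
    have he : (stationaryConfig γ γ' τ n).1 i =
        ((2 * γ * ((i : ℝ) + 1) + γ') / (2 * γ * ((n : ℝ) + 1) + 2 * γ')) * τ := by
      rw [stationaryConfig, stationaryVelocity]; ring
    have hq : (2 * γ * ((i : ℝ) + 1) + γ') / (2 * γ * ((n : ℝ) + 1) + 2 * γ') ≤ 1 := by
      rw [div_le_one hD]; nlinarith
    rw [he, mul_pow]
    exact mul_le_of_le_one_left (sq_nonneg _) (pow_le_one₀ (by positivity) hq)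
  have h2 := Finset.sum_le_sum fun i (_ : i ∈ Finset.univ) => h1 i
  have h3 := sq_stationaryVelocity_le (n := n) τ hγ hγ'
  have h4 : τ ^ 2 / (4 * γ ^ 2 * ((n : ℝ) + 1)) ≤ τ ^ 2 / (4 * γ ^ 2) * ((n : ℝ) + 1) := by
    have hn : (1 : ℝ) ≤ (n : ℝ) + 1 := by simp
    calc τ ^ 2 / (4 * γ ^ 2 * ((n : ℝ) + 1)) ≤ τ ^ 2 / (4 * γ ^ 2) :=
          div_le_div_of_nonneg_left (sq_nonneg τ) (by positivity)
            (le_mul_of_one_le_right (by positivity) hn)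
      _ ≤ _ := le_mul_of_one_le_right (by positivity) hn
  simp only [Finset.sum_const, Finset.card_univ, Fintype.card_fin, nsmul_eq_mul] at h2
  rw [totalEnergy_eq]
  simp only [stationaryConfig, Finset.sum_const, Finset.card_univ, Fintype.card_fin, nsmul_eq_mul,
    Nat.cast_add, Nat.cast_one] at h2 ⊢
  have h5 : τ ^ 2 / (8 * γ ^ 2) = τ ^ 2 / (4 * γ ^ 2) / 2 := by ring
  rw [h5]
  nlinarith [sq_nonneg τ]

/-- Dissipation of the energy of a solution of the homogeneous equations. -/
lemma energyDifferential_drift_zero (γ γ' : ℝ) (w : Config n) :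
    energyDifferential w (drift γ γ' 0 w) =
      -(2 * γ * ∑ x, w.2 x ^ 2 + γ' * (w.2 0 ^ 2 + w.2 (Fin.last n) ^ 2)) := by
  have h : energyDifferential w (0, w.2) = ∑ x, w.2 x ^ 2 := by
    rw [energyDifferential_apply]; simp [sq]
  simp only [drift, map_sub, map_smul, energyDifferential_hamiltonianField, h,
    energyDifferential_single, smul_eq_mul]
  ring

lemma totalEnergy_add (a b : Config n) :
    totalEnergy (a + b) = totalEnergy a + energyDifferential a b + totalEnergy b := by
  simp only [totalEnergy_eq, energyDifferential_apply, Prod.fst_add, Prod.snd_add, Pi.add_apply,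
    add_sq, Finset.sum_add_distrib, mul_assoc, ← Finset.mul_sum]
  ring

lemma totalEnergy_neg (b : Config n) : totalEnergy (-b) = totalEnergy b := by
  simp [totalEnergy_eq]

/-- From the parallelogram identity, dropping the energy of `a - b`. -/
lemma totalEnergy_add_le (a b : Config n) :
    totalEnergy (a + b) ≤ 2 * totalEnergy a + 2 * totalEnergy b := by
  have h1 := totalEnergy_add a b
  have h2 := totalEnergy_add a (-b)
  have h3 := totalEnergy_nonneg (a + -b)
  rw [map_neg, totalEnergy_neg] at h2
  linarith

/-- Jensen's inequality, by integrating the tangent-plane bound of the quadratic form at the mean.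
-/
lemma totalEnergy_integral_le {Ω : Type*} [MeasurableSpace Ω] {P : Measure Ω}
    [IsProbabilityMeasure P] {Z : Ω → Config n} (hZ : Integrable Z P)
    (hE : Integrable (fun ω => totalEnergy (Z ω)) P) :
    totalEnergy (∫ ω, Z ω ∂P) ≤ ∫ ω, totalEnergy (Z ω) ∂P := by
  set a := ∫ ω, Z ω ∂P with ha
  have hi : Integrable (fun ω => energyDifferential a (Z ω)) P :=
    (energyDifferential a).integrable_comp hZ
  have h1 : ∀ ω, totalEnergy a + (energyDifferential a (Z ω) - energyDifferential a a) ≤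
      totalEnergy (Z ω) := fun ω => by
    have h := totalEnergy_add a (Z ω - a)
    rw [add_sub_cancel, map_sub] at h
    linarith [totalEnergy_nonneg (Z ω - a)]
  have hd : Integrable (fun ω => energyDifferential a (Z ω) - energyDifferential a a) P :=
    hi.sub (integrable_const _)
  have hs : Integrable (fun ω => totalEnergy a +
      (energyDifferential a (Z ω) - energyDifferential a a)) P := (integrable_const _).add hd
  have h3 : ∫ ω, (totalEnergy a + (energyDifferential a (Z ω) - energyDifferential a a)) ∂P =
      totalEnergy a := by
    rw [integral_add (integrable_const _) hd, integral_sub hi (integrable_const _),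
      (energyDifferential a).integral_comp_comm hZ]
    simp [← ha]
  exact h3.symm.le.trans (integral_mono hs hE h1)

lemma continuousOn_config {z : ℝ → Config n} {s : Set ℝ}
    (h : ∀ L : Config n →L[ℝ] ℝ, ContinuousOn (fun t => L (z t)) s) : ContinuousOn z s :=
  ContinuousOn.prodMk
    (continuousOn_pi.2 fun i => h ((ContinuousLinearMap.proj (R := ℝ) (φ := fun _ : Fin n => ℝ) i).comp
      (ContinuousLinearMap.fst ℝ (Fin n → ℝ) (Fin (n + 1) → ℝ))))
    (continuousOn_pi.2 fun x => h ((ContinuousLinearMap.proj (R := ℝ)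
      (φ := fun _ : Fin (n + 1) => ℝ) x).comp
      (ContinuousLinearMap.snd ℝ (Fin n → ℝ) (Fin (n + 1) → ℝ))))

lemma hasDerivAt_config {z : ℝ → Config n} {z' : Config n} {s : ℝ}
    (h : ∀ L : Config n →L[ℝ] ℝ, HasDerivAt (fun t => L (z t)) (L z') s) : HasDerivAt z z' s :=
  HasDerivAt.prodMk
    (hasDerivAt_pi.2 fun i => h ((ContinuousLinearMap.proj (R := ℝ) (φ := fun _ : Fin n => ℝ) i).comp
      (ContinuousLinearMap.fst ℝ (Fin n → ℝ) (Fin (n + 1) → ℝ))))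
    (hasDerivAt_pi.2 fun x => h ((ContinuousLinearMap.proj (R := ℝ)
      (φ := fun _ : Fin (n + 1) => ℝ) x).comp
      (ContinuousLinearMap.snd ℝ (Fin n → ℝ) (Fin (n + 1) → ℝ))))

/-- Solutions of the integrated equations of the means are continuous, and differentiable. -/
lemma continuousOn_and_hasDerivAt_of_integral_eq {z : ℝ → Config n} {t : ℝ}
    (hz : ∀ L : Config n →L[ℝ] ℝ, ∀ s ∈ Set.Icc 0 t,
      IntervalIntegrable (fun u => (n : ℝ) ^ 2 * L (drift γ γ' τ (z u))) volume 0 s ∧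
      L (z s) = L (z 0) + ∫ u in (0 : ℝ)..s, (n : ℝ) ^ 2 * L (drift γ γ' τ (z u))) (ht : 0 ≤ t) :
    ContinuousOn z (Set.Icc 0 t) ∧
      ∀ s ∈ Set.Ioo 0 t, HasDerivAt z ((n : ℝ) ^ 2 • drift γ γ' τ (z s)) s := by
  -- Bootstrap: integrability of the right-hand side makes `z` continuous, hence the right-hand side
  -- is continuous and `z` is differentiable.
  have hc : ContinuousOn z (Set.Icc 0 t) := continuousOn_config fun L => by
    have h := (hz L t (Set.right_mem_Icc.2 ht)).1
    have h1 := intervalIntegral.continuousOn_primitive_interval' h Set.left_mem_uIcc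
    rw [Set.uIcc_of_le ht] at h1
    exact (continuousOn_const.add h1).congr fun s hs => (hz L s hs).2
  refine ⟨hc, fun s hs => hasDerivAt_config fun L => ?_⟩
  have hg : ContinuousOn (fun u => (n : ℝ) ^ 2 * L (drift γ γ' τ (z u))) (Set.Ioo 0 t) :=
    continuousOn_const.mul ((L.continuous.comp (continuous_drift γ γ' τ)).comp_continuousOn
      (hc.mono Set.Ioo_subset_Icc_self))
  have hd := (intervalIntegral.integral_hasDerivAt_right (hz L s ⟨hs.1.le, hs.2.le⟩).1
    (hg.stronglyMeasurableAtFilter isOpen_Ioo s hs)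
    (hg.continuousAt (isOpen_Ioo.mem_nhds hs))).const_add (L (z 0))
  rw [map_smul, smul_eq_mul]
  refine hd.congr_of_eventuallyEq ?_
  filter_upwards [isOpen_Ioo.mem_nhds hs] with u hu
  exact (hz L u ⟨hu.1.le, hu.2.le⟩).2

/-- The energy balance of the deviation from the stationary solution. -/
lemma totalEnergy_deviation_add_le (hγ : 0 < γ) (hγ' : 0 < γ') {z : ℝ → Config n} {t : ℝ}
    (ht : 0 ≤ t) (hc : ContinuousOn z (Set.Icc 0 t))
    (hd : ∀ s ∈ Set.Ioo 0 t, HasDerivAt z ((n : ℝ) ^ 2 • drift γ γ' τ (z s)) s) :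
    totalEnergy (z t - stationaryConfig γ γ' τ n) +
      2 * γ * (n : ℝ) ^ 2 * ∫ s in (0 : ℝ)..t,
        ∑ x, ((z s).2 x - stationaryVelocity γ γ' τ n) ^ 2 ≤
      totalEnergy (z 0 - stationaryConfig γ γ' τ n) := by
  set a := stationaryConfig γ γ' τ n
  have hdr : ∀ s, drift γ γ' τ (z s) = drift γ γ' 0 (z s - a) := fun s => by
    have h := drift_add γ γ' 0 τ (z s - a) a
    rwa [drift_stationaryConfig τ hγ hγ', zero_add, add_zero, sub_add_cancel] at h
  have hw : ContinuousOn (fun s => z s - a) (Set.Icc 0 t) := hc.sub continuousOn_const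
  have hp : ∀ x, ContinuousOn (fun s => (z s - a).2 x) (Set.Icc 0 t) := fun x =>
    ((continuous_apply x).comp continuous_snd).comp_continuousOn hw
  have hf : ContinuousOn (fun s => totalEnergy (z s - a)) (Set.Icc 0 t) :=
    continuous_totalEnergy.comp_continuousOn hw
  have hf' : ∀ s ∈ Set.Ioo 0 t, HasDerivAt (fun s => totalEnergy (z s - a))
      ((n : ℝ) ^ 2 * -(2 * γ * ∑ x, (z s - a).2 x ^ 2 +
        γ' * ((z s - a).2 0 ^ 2 + (z s - a).2 (Fin.last n) ^ 2))) s := fun s hs => by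
    have h := (hasFDerivAt_totalEnergy (z s - a)).comp_hasDerivAt s ((hd s hs).sub_const a)
    rwa [map_smul, hdr, energyDifferential_drift_zero, smul_eq_mul] at h
  have hS : ContinuousOn (fun s => ∑ x, (z s - a).2 x ^ 2) (Set.Icc 0 t) :=
    continuousOn_finsetSum _ fun x _ => (hp x).pow 2
  have hSi : IntervalIntegrable (fun s => ∑ x, (z s - a).2 x ^ 2) volume 0 t :=
    ContinuousOn.intervalIntegrable (by rwa [Set.uIcc_of_le ht])
  have hI : IntervalIntegrable (fun s => (n : ℝ) ^ 2 * -(2 * γ * ∑ x, (z s - a).2 x ^ 2 +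
        γ' * ((z s - a).2 0 ^ 2 + (z s - a).2 (Fin.last n) ^ 2))) volume 0 t := by
    refine ContinuousOn.intervalIntegrable ?_
    rw [Set.uIcc_of_le ht]
    exact continuousOn_const.mul (((continuousOn_const.mul hS).add
      (continuousOn_const.mul (((hp 0).pow 2).add ((hp _).pow 2)))).neg)
  have hFTC := intervalIntegral.integral_eq_sub_of_hasDerivAt_of_le ht hf hf' hI
  -- The dissipation at the two thermostats is discarded; the bulk friction suffices.
  have hle := intervalIntegral.integral_mono_on ht hI
    (hSi.const_mul (-(2 * γ * (n : ℝ) ^ 2))) fun s _ => by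
      have : 0 ≤ (n : ℝ) ^ 2 * (γ' * ((z s - a).2 0 ^ 2 + (z s - a).2 (Fin.last n) ^ 2)) := by
        positivity
      show _ ≤ -(2 * γ * (n : ℝ) ^ 2) * ∑ x, (z s - a).2 x ^ 2
      linarith
  rw [hFTC, intervalIntegral.integral_const_mul] at hle
  have e : ∀ s x, (z s).2 x - stationaryVelocity γ γ' τ n = (z s - a).2 x := fun s x => rfl
  simp only [e]
  linarith

end LinearFlow

/-! ### Bounds for the means of a single chain -/

section Means

variable {Ω : Type*} [MeasurableSpace Ω] {P : Measure Ω} {X : ℝ≥0 → Ω → Config n}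
  {γ γ' τ Tm Tp : ℝ}

lemma integral_fst_apply {Z : Ω → Config n} (hZ : Integrable Z P) (i : Fin n) :
    Integrable (fun ω => (Z ω).1 i) P ∧ ∫ ω, (Z ω).1 i ∂P = (∫ ω, Z ω ∂P).1 i := by
  let L := (ContinuousLinearMap.proj (R := ℝ) (φ := fun _ : Fin n => ℝ) i).comp
      (ContinuousLinearMap.fst ℝ (Fin n → ℝ) (Fin (n + 1) → ℝ))
  exact ⟨L.integrable_comp hZ, L.integral_comp_comm hZ⟩

lemma integral_snd_apply {Z : Ω → Config n} (hZ : Integrable Z P) (x : Fin (n + 1)) :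
    Integrable (fun ω => (Z ω).2 x) P ∧ ∫ ω, (Z ω).2 x ∂P = (∫ ω, Z ω ∂P).2 x := by
  let L := (ContinuousLinearMap.proj (R := ℝ) (φ := fun _ : Fin (n + 1) => ℝ) x).comp
      (ContinuousLinearMap.snd ℝ (Fin n → ℝ) (Fin (n + 1) → ℝ))
  exact ⟨L.integrable_comp hZ, L.integral_comp_comm hZ⟩

lemma integrable_stretch {t : ℝ≥0} (hZ : Integrable (X t) P) (x : Fin (n + 1)) :
    Integrable (fun ω => stretch (X t ω) x) P := by
  refine Fin.cases ?_ (fun i => ?_) x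
  · simp [stretch]
  · simpa [stretch] using (integral_fst_apply hZ i).1

lemma meanStretch_eq {t : ℝ≥0} (hZ : Integrable (X t) P) (x : Fin (n + 1)) :
    meanStretch P X t x = stretch (∫ ω, X t ω ∂P) x := by
  refine Fin.cases ?_ (fun i => ?_) x
  · simp [meanStretch, stretch]
  · simpa [meanStretch, stretch] using (integral_fst_apply hZ i).2

lemma sum_sq_means_eq {t : ℝ≥0} (hZ : Integrable (X t) P) :
    ∑ x, (meanStretch P X t x ^ 2 + meanMomentum P X t x ^ 2) =
      2 * totalEnergy (∫ ω, X t ω ∂P) := by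
  rw [totalEnergy, Finset.mul_sum]
  refine Finset.sum_congr rfl fun x _ => ?_
  rw [meanStretch_eq hZ, meanMomentum, energy]
  simp only [momentum]
  rw [(integral_snd_apply hZ x).2]
  ring

namespace IsChainProcess

/-- The bounds for a single chain, in terms of the initial mean energy `E`. -/
lemma means_bounds (h : IsChainProcess γ γ' τ Tm Tp P X) (hγ : 0 < γ) (hγ' : 0 < γ')
    (hTm : 0 < Tm) (hTp : 0 < Tp) (h0 : ∀ x, Integrable (fun ω => energy (X 0 ω) x) P) {K : ℝ}
    (hK : ∑ x, meanEnergy P X 0 x ≤ K * ((n : ℝ) + 1)) (hn : 1 ≤ n) (t : ℝ≥0) :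
    (Integrable (X t) P ∧ ∑ x, (meanStretch P X t x ^ 2 + meanMomentum P X t x ^ 2) ≤
      4 * (2 * K + 3 * (τ ^ 2 / 2 + τ ^ 2 / (8 * γ ^ 2))) * ((n : ℝ) + 1)) ∧
    (∀ x, IntervalIntegrable (fun s : ℝ => meanMomentum P X s.toNNReal x ^ 2) volume 0 t) ∧
      (n : ℝ) * ∑ x, ∫ s in (0 : ℝ)..t, meanMomentum P X s.toNNReal x ^ 2 ≤
        2 * (2 * K + 2 * (τ ^ 2 / 2 + τ ^ 2 / (8 * γ ^ 2))) / γ + t * (τ ^ 2 / (2 * γ ^ 2)) := by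
  have := h.isProbabilityMeasure
  have hE0 : Integrable (fun ω => totalEnergy (X 0 ω)) P := integrable_finsetSum _ fun x _ => h0 x
  have hEK : ∫ ω, totalEnergy (X 0 ω) ∂P ≤ K * ((n : ℝ) + 1) := by
    simp only [totalEnergy]
    rw [integral_finsetSum _ fun x _ => h0 x]
    exact hK
  have hZ := h.integrable_config hγ' hTm hTp hE0
  set z : ℝ → Config n := fun s => ∫ ω, X s.toNNReal ω ∂P with hz
  set a := stationaryConfig γ γ' τ n
  set S := τ ^ 2 / 2 + τ ^ 2 / (8 * γ ^ 2) with hS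
  have ha : totalEnergy a ≤ S * ((n : ℝ) + 1) := totalEnergy_stationaryConfig_le τ hγ hγ'
  have hA : totalEnergy (z 0 - a) ≤ (2 * K + 2 * S) * ((n : ℝ) + 1) := by
    have h1 := totalEnergy_add_le (z 0) (-a)
    have h2 : totalEnergy (z 0) ≤ ∫ ω, totalEnergy (X 0 ω) ∂P := by
      simpa [hz] using totalEnergy_integral_le (hZ 0) hE0
    rw [totalEnergy_neg, ← sub_eq_add_neg] at h1
    linarith
  have heq : ∀ L : Config n →L[ℝ] ℝ, ∀ s ∈ Set.Icc (0 : ℝ) t,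
      IntervalIntegrable (fun u => (n : ℝ) ^ 2 * L (drift γ γ' τ (z u))) volume 0 s ∧
      L (z s) = L (z 0) + ∫ u in (0 : ℝ)..s, (n : ℝ) ^ 2 * L (drift γ γ' τ (z u)) := by
    intro L s hs
    have h1 := h.integral_config_eq hγ' hTm hTp hE0 L s.toNNReal
    simp only [integral_drift γ γ' τ (hZ _), L.integral_comp_comm (hZ _),
      Real.coe_toNNReal s hs.1] at h1
    simpa [hz] using h1
  obtain ⟨hc, hd⟩ := continuousOn_and_hasDerivAt_of_integral_eq τ heq t.coe_nonneg
  have hbal := totalEnergy_deviation_add_le τ hγ hγ' t.coe_nonneg hc hd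
  set v := stationaryVelocity γ γ' τ n
  have hI0 : 0 ≤ ∫ s in (0 : ℝ)..t, ∑ x, ((z s).2 x - v) ^ 2 :=
    intervalIntegral.integral_nonneg t.coe_nonneg fun s _ => Finset.sum_nonneg fun x _ =>
      sq_nonneg _
  have hn0 : (1 : ℝ) ≤ n := by exact_mod_cast hn
  have hmom : ∀ s : ℝ, ∀ x, meanMomentum P X s.toNNReal x = (z s).2 x := fun s x =>
    (integral_snd_apply (hZ _) x).2
  have hpc : ∀ x, ContinuousOn (fun s => (z s).2 x) (Set.Icc 0 t) := fun x =>
    ((continuous_apply x).comp continuous_snd).comp_continuousOn hc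
  have hpi : ∀ x, IntervalIntegrable (fun s => (z s).2 x ^ 2) volume 0 t := fun x =>
    ContinuousOn.intervalIntegrable (by
      rw [Set.uIcc_of_le t.coe_nonneg]; exact (hpc x).pow 2)
  have hwi : IntervalIntegrable (fun s => ∑ x, ((z s).2 x - v) ^ 2) volume 0 t :=
    ContinuousOn.intervalIntegrable (by
      rw [Set.uIcc_of_le t.coe_nonneg]
      exact continuousOn_finsetSum _ fun x _ => ((hpc x).sub continuousOn_const).pow 2)
  have hsi : IntervalIntegrable (fun s => ∑ x, (z s).2 x ^ 2) volume 0 t :=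
    ContinuousOn.intervalIntegrable (by
      rw [Set.uIcc_of_le t.coe_nonneg]
      exact continuousOn_finsetSum _ fun x _ => (hpc x).pow 2)
  refine ⟨⟨hZ t, ?_⟩, ?_, ?_⟩
  · rw [sum_sq_means_eq (hZ t)]
    have h1 := totalEnergy_add_le (z t - a) a
    have h2 : z t = ∫ ω, X t ω ∂P := by simp [hz]
    rw [sub_add_cancel, h2] at h1
    rw [h2] at hbal
    -- Without the dissipation, the deviation has energy at most `(2K + 2S)(n + 1)` at time `t`;
    -- adding back `a` gives `2 (2 (2K + 2S) + 2S) = 4 (2K + 3S)` per site.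
    have h3 : 0 ≤ 2 * γ * (n : ℝ) ^ 2 * ∫ s in (0 : ℝ)..t, ∑ x, ((z s).2 x - v) ^ 2 := by
      positivity
    linarith
  · simpa only [hmom] using hpi
  · simp only [hmom]
    rw [← intervalIntegral.integral_finsetSum fun x _ => hpi x]
    set J := ∫ s in (0 : ℝ)..t, ∑ x, ((z s).2 x - v) ^ 2 with hJ
    have hle : ∫ s in (0 : ℝ)..t, ∑ x, (z s).2 x ^ 2 ≤ 2 * J + t * (2 * (((n : ℝ) + 1) * v ^ 2)) := by
      have h1 := intervalIntegral.integral_mono_on t.coe_nonneg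
        (f := fun s => ∑ x, (z s).2 x ^ 2)
        (g := fun s => 2 * (∑ x, ((z s).2 x - v) ^ 2) + 2 * (((n : ℝ) + 1) * v ^ 2))
        hsi
        ((hwi.const_mul 2).add intervalIntegrable_const) fun s _ => by
          have h2 : ∀ x, (z s).2 x ^ 2 ≤ 2 * ((z s).2 x - v) ^ 2 + 2 * v ^ 2 := fun x => by
            nlinarith [sq_nonneg ((z s).2 x - 2 * v)]
          refine (Finset.sum_le_sum fun x _ => h2 x).trans (le_of_eq ?_)
          rw [Finset.sum_add_distrib, ← Finset.mul_sum]
          simp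
          ring
      rw [intervalIntegral.integral_add (hwi.const_mul 2) intervalIntegrable_const,
        intervalIntegral.integral_const_mul, intervalIntegral.integral_const] at h1
      simpa using h1
    have hv := sq_stationaryVelocity_le (n := n) τ hγ hγ'
    have hJn : (n : ℝ) * (2 * J) ≤ 2 * (2 * K + 2 * S) / γ := by
      have h1 : 2 * γ * (n : ℝ) ^ 2 * J ≤ (2 * K + 2 * S) * ((n : ℝ) + 1) := by
        linarith [totalEnergy_nonneg (z t - a)]
      have hKS : 0 ≤ 2 * K + 2 * S := by
        have := (totalEnergy_nonneg (z 0 - a)).trans hA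
        exact nonneg_of_mul_nonneg_left this (by positivity)
      rw [le_div_iff₀ hγ]
      -- Here `n ≥ 1` enters through `n + 1 ≤ 2n`; one factor `n` is then cancelled.
      have h2 : (n : ℝ) * (n * (2 * J) * γ) ≤ n * (2 * (2 * K + 2 * S)) := by
        nlinarith
      exact le_of_mul_le_mul_left h2 (by linarith)
    have hvn : (n : ℝ) * (2 * (((n : ℝ) + 1) * v ^ 2)) ≤ τ ^ 2 / (2 * γ ^ 2) := by
      calc (n : ℝ) * (2 * (((n : ℝ) + 1) * v ^ 2))
          ≤ ((n : ℝ) + 1) * (2 * (τ ^ 2 / (4 * γ ^ 2 * ((n : ℝ) + 1)))) := by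
            gcongr; linarith
        _ = _ := by field_simp; ring
    calc (n : ℝ) * ∫ s in (0 : ℝ)..t, ∑ x, (z s).2 x ^ 2
        ≤ n * (2 * J + t * (2 * (((n : ℝ) + 1) * v ^ 2))) := by gcongr
      _ = n * (2 * J) + t * (n * (2 * (((n : ℝ) + 1) * v ^ 2))) := by ring
      _ ≤ _ := by gcongr

end IsChainProcess

end Means

end OscillatorChain

end

/-! ### Uniformity in the size of the chain -/

open OscillatorChain
theorem proposition4p3 {γ γ' τ Tm Tp : ℝ} (hγ : 0 < γ) (hγ' : 0 < γ') (hTm : 0 < Tm) (hTp : 0 < Tp)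
    {Ω : ℕ → Type*} [∀ n, MeasurableSpace (Ω n)] (P : ∀ n, Measure (Ω n))
    (X : ∀ n, ℝ≥0 → Ω n → Config n)
    (hX : ∀ n, 1 ≤ n → IsChainProcess γ γ' τ Tm Tp (P n) (X n))
    (hE : InitialEnergyBound P X) (hS : InitialSpectralBound P X) :
    (∀ t : ℝ≥0, 0 < t → ∃ C : ℝ, 0 < C ∧ ∀ n : ℕ, 1 ≤ n → ∀ s : ℝ≥0, s ≤ t →
      (∀ x, Integrable (fun ω => stretch (X n s ω) x) (P n) ∧
        Integrable (fun ω => momentum (X n s ω) x) (P n)) ∧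
      1 / ((n : ℝ) + 1) * ∑ x, (meanStretch (P n) (X n) s x ^ 2 +
        meanMomentum (P n) (X n) s x ^ 2) ≤ C) ∧
    (∀ t : ℝ≥0, 0 < t → ∃ C : ℝ, 0 < C ∧ ∀ n : ℕ, 1 ≤ n →
      (∀ x, IntervalIntegrable (fun s : ℝ => meanMomentum (P n) (X n) s.toNNReal x ^ 2)
        volume 0 t) ∧
      (n : ℝ) * ∑ x, ∫ s in (0 : ℝ)..t, meanMomentum (P n) (X n) s.toNNReal x ^ 2 ≤ C) := by
  obtain ⟨K, hK⟩ := hE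
  have hB := fun n (hn : 1 ≤ n) => (hX n hn).means_bounds (K := K) hγ hγ' hTm hTp (hK n hn).1
    (by
      have h := (hK n hn).2
      rwa [one_div, inv_mul_le_iff₀ (by positivity), mul_comm] at h) hn
  constructor
  · intro t _
    -- This constant does not depend on `t`; the maximum with `1` only makes it positive.
    refine ⟨max (4 * (2 * K + 3 * (τ ^ 2 / 2 + τ ^ 2 / (8 * γ ^ 2)))) 1,
      lt_max_of_lt_right one_pos, fun n hn s _ => ?_⟩
    obtain ⟨⟨hi, hb⟩, -⟩ := hB n hn s
    refine ⟨fun x => ⟨integrable_stretch hi x, (integral_snd_apply hi x).1⟩, ?_⟩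
    refine le_trans ?_ (le_max_left _ _)
    rwa [one_div, inv_mul_le_iff₀ (by positivity), mul_comm]
  · intro t _
    exact ⟨max _ 1, lt_max_of_lt_right one_pos, fun n hn => ⟨(hB n hn t).2.1,
      (hB n hn t).2.2.trans (le_max_left _ _)⟩⟩
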